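/- Let $p$ be a prime and let $R$ be a pro-$p$ domain of characteristic $p$, that is, a Noetherian local integral domain of characteristic $p$ with maximal ideal $\mathfrak m$ and finite residue field, complete in its $\mathfrak m$-adic topology. **Definitions.** *(Hausdorff spectrum.)* Let $G$ be an infinite profinite group and $\{G_n\}_{n\in\mathbb N}$ a descending sequence of open subgroups with $\bigcap_n G_n=\{1\}$. Write $\mathrm{hdim}_{\{G_n\}}(X)$ for the Hausdorff dimension of $X\subseteq G$ with respect to the metric $d(x,y)=\inf\{|G:G_n|^{-1} : xy^{-1}\in G_n\}$ (with $\inf\varnothing=\infty$), and $$\mathrm{hspec}_{\{G_n\}}(G)=\{\mathrm{hdim}_{\{G_n\}}(H) : H\le G \text{ a closed subgroup}\}.$$ *($R$-standard groups.)* An $R$-standard group $(S,\phi)$ of level $N\ge 1$ and dimension $d$ is a topological group $S$ with a homeomorphism $\phi\colon S\to(\mathfrak m^N)^{(d)}$ such that $\phi(1)=\mathbf 0$ and $\phi(xy)=\mathbf F(\phi(x),\phi(y))$ for all $x,y\in S$, where $\mathbf F\in R[[\mathbf X,\mathbf Y]]^{(d)}$ is a formal group law over $R$. Its $R$-standard filtration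 consists of the subgroups $S_n=\phi^{-1}\big((\mathfrak m^{N+n})^{(d)}\big)$, $n\in\mathbb N$. *($R$-analytic groups.)* A function between open subsets of $R^{(r)}$ and $R^{(s)}$ is $R$-analytic if around each point $y$ of its domain, on some $y+(\mathfrak m^N)^{(r)}$, it is given by convergent power series in $x-y$ with coefficients in $R$. An $R$-analytic group of dimension $d$ is a topological group with an atlas of $R$-analytically compatible charts onto open subsets of $R^{(d)}$ for which multiplication and inversion are $R$-analytic. An open $R$-standard subgroup of an $R$-analytic group $G$ is an $R$-standard group $(S,\phi)$ such that $S$ is an open subgroup of $G$ and $\phi$ is $R$-analytically compatible with the charts of $G$. If $G$ is compact and infinite, a closed subgroup $H\le G$ has standard Hausdorff dimension $\alpha$ if $G$ has an open $R$-standard subgroup and $\mathrm{hdim}_{\{S_n\}}(H)=\alpha$, computed in $G$, for every open $R$-standard subgroup $(S,\phi)$ of $G$. The standard Hausdorff spectrum of $G$ is the set of the standard Hausdorff dimensions of its closed subgroups. **Statement.** 1. If $(S,\phi)$ is an infinite abelian $R$-standard group, then its Hausdorff spectrum with respect to its $R$-standard filtration is full: $\mathrm{hspec}_{\{S_n\}}(S)=[0,1]$.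 2. If $G$ is an infinite abelian compact $R$-analytic group, then every closed subgroup of $G$ has a standard Hausdorff dimension, and the standard Hausdorff spectrum of $G$ is $[0,1]$. -/

import Mathlib

open scoped ENNReal Topology

namespace RAnalytic

/-! ### Pro-`p` domains -/

/-- A pro-`p` domain: a Noetherian local integral domain which is complete with respect to its
maximal ideal and has finite residue field of characteristic `p`, with the `𝔪`-adic topology. -/
class IsProPDomain (p : outParam ℕ) (R : Type*) [CommRing R] [TopologicalSpace R] : Prop
    extends IsDomain R, IsLocalRing R, IsNoetherianRing R where
  isAdic : IsAdic (IsLocalRing.maximalIdeal R)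
  isAdicComplete : IsAdicComplete (IsLocalRing.maximalIdeal R) R
  finite_residueField : Finite (IsLocalRing.ResidueField R)
  charP_residueField : CharP (IsLocalRing.ResidueField R) p

/-- The `k`-th power `𝔪 ^ k` of the maximal ideal. -/
abbrev mpow (R : Type*) [CommRing R] [IsLocalRing R] (k : ℕ) : Ideal R :=
  IsLocalRing.maximalIdeal R ^ k

theorem isTopologicalRing {p : ℕ} {R : Type*} [CommRing R] [TopologicalSpace R]
    [IsProPDomain p R] : IsTopologicalRing R := by
  have aux : ∀ (t : TopologicalSpace R) (I : Ideal R), @IsAdic R _ t I →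
      @IsTopologicalRing R t _ := by
    intro t I h
    unfold IsAdic at h
    subst h
    exact @NonarchimedeanRing.toIsTopologicalRing R _ I.adicTopology I.nonarchimedean
  exact aux _ _ IsProPDomain.isAdic

section ProP

variable {p : ℕ} {R : Type*} [CommRing R] [TopologicalSpace R] [IsProPDomain p R]

theorem isOpen_mpow (k : ℕ) : IsOpen (mpow R k : Set R) := by
  have := isTopologicalRing (R := R)
  exact (isAdic_iff.1 (IsProPDomain.isAdic (R := R))).1 k

theorem isClosed_mpow (k : ℕ) : IsClosed (mpow R k : Set R) := by
  have := isTopologicalRing (R := R)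
  exact (mpow R k).toAddSubgroup.isClosed_of_isOpen (isOpen_mpow k)

theorem eq_zero_of_forall_mem_mpow {x : R} (h : ∀ k, x ∈ mpow R k) : x = 0 := by
  have := Ideal.iInf_pow_eq_bot_of_isLocalRing (IsLocalRing.maximalIdeal R)
    (IsLocalRing.maximalIdeal.isMaximal R).ne_top
  rw [← Ideal.mem_bot, ← this]
  exact Ideal.mem_iInf.2 h

end ProP

/-! ### Power series, analytic functions and formal group laws -/

/-- `HasValue F x v`: the power series `F`, evaluated at the point `x`, converges to `v`. -/
def HasValue {R ι : Type*} [CommRing R] [TopologicalSpace R]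
    (F : MvPowerSeries ι R) (x : ι → R) (v : R) : Prop :=
  HasSum (fun n : ι →₀ ℕ => MvPowerSeries.coeff n F * n.prod fun i k => x i ^ k) v

/-- `f` is `R`-analytic at `y`: on a neighbourhood `y + (𝔪 ^ N)^ι` it is given by convergent
power series with coefficients in `R`. -/
def RAnalyticAt {R ι κ : Type*} [CommRing R] [TopologicalSpace R] [IsLocalRing R]
    (f : (ι → R) → (κ → R)) (y : ι → R) : Prop :=
  ∃ (N : ℕ) (F : κ → MvPowerSeries ι R), ∀ x : ι → R, (∀ i, x i ∈ mpow R N) →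
    ∀ j, HasValue (F j) x (f (y + x) j)

/-- A `d`-dimensional formal group law over `R`: a `d`-tuple of power series
`F(X, Y)` in two `d`-tuples of variables (`Sum.inl i` is `X_i`, `Sum.inr i` is `Y_i`) such that
`F(X, 0) = X`, `F(0, Y) = Y` and `F(F(X, Y), Z) = F(X, F(Y, Z))`. -/
structure FormalGroupLaw (R : Type*) [CommRing R] (d : ℕ) where
  toFun : Fin d → MvPowerSeries (Fin d ⊕ Fin d) R
  right_zero : ∀ i, MvPowerSeries.subst
    (Sum.elim MvPowerSeries.X fun _ => 0 : Fin d ⊕ Fin d → MvPowerSeries (Fin d) R) (toFun i)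
      = MvPowerSeries.X i
  left_zero : ∀ i, MvPowerSeries.subst
    (Sum.elim (fun _ => 0) MvPowerSeries.X : Fin d ⊕ Fin d → MvPowerSeries (Fin d) R) (toFun i)
      = MvPowerSeries.X i
  assoc : ∀ i,
    MvPowerSeries.subst
      (Sum.elim
        (fun j => MvPowerSeries.subst
          (Sum.elim (fun k => MvPowerSeries.X (Sum.inl k))
            (fun k => MvPowerSeries.X (Sum.inr (Sum.inl k)))) (toFun j))
        (fun j => MvPowerSeries.X (Sum.inr (Sum.inr j))) :
        Fin d ⊕ Fin d → MvPowerSeries (Fin d ⊕ Fin d ⊕ Fin d) R) (toFun i)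
    = MvPowerSeries.subst
      (Sum.elim
        (fun j => MvPowerSeries.X (Sum.inl j))
        (fun j => MvPowerSeries.subst
          (Sum.elim (fun k => MvPowerSeries.X (Sum.inr (Sum.inl k)))
            (fun k => MvPowerSeries.X (Sum.inr (Sum.inr k)))) (toFun j)) :
        Fin d ⊕ Fin d → MvPowerSeries (Fin d ⊕ Fin d ⊕ Fin d) R) (toFun i)

theorem FormalGroupLaw.coeff_eq {R : Type*} [CommRing R] {d : ℕ} (F : FormalGroupLaw R d)
    (i : Fin d) (n : Fin d ⊕ Fin d →₀ ℕ) (hn : ∀ j, n (Sum.inl j) = 0) :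
    MvPowerSeries.coeff n (F.toFun i) = if n = Finsupp.single (Sum.inr i) 1 then 1 else 0 := by
  classical
  set a : Fin d ⊕ Fin d → MvPowerSeries (Fin d) R :=
    Sum.elim (fun _ => 0) MvPowerSeries.X with ha
  have hs : MvPowerSeries.HasSubst a := by
    apply MvPowerSeries.hasSubst_of_constantCoeff_zero
    rintro (j | j) <;> simp [ha]
  have key := congrArg (MvPowerSeries.coeff (n.comapDomain Sum.inr Sum.inr_injective.injOn))
    (F.left_zero i)
  rw [MvPowerSeries.coeff_subst hs, finsum_eq_single _ n] at key
  · have hprod : (n.prod fun s e => a s ^ e) =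
        MvPowerSeries.monomial (n.comapDomain Sum.inr Sum.inr_injective.injOn) (1 : R) := by
      rw [Finsupp.prod_fintype _ _ (by simp), Fintype.prod_sum_type]
      simp [ha, hn, MvPowerSeries.monomial_one_eq, Finsupp.prod_fintype]
    rw [hprod, MvPowerSeries.coeff_monomial_same, smul_eq_mul, mul_one] at key
    rw [key, MvPowerSeries.coeff_X]
    congr 1
    apply propext
    constructor
    · intro h
      ext (j | j)
      · simp [hn]
      · have := DFunLike.congr_fun h j
        simpa [Finsupp.single_apply] using this
    · intro h
      ext j
      rw [h]
      simp [Finsupp.single_apply]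
  · intro m hm
    rw [Finsupp.prod_fintype _ _ (by simp), Fintype.prod_sum_type]
    by_cases h0 : ∀ j, m (Sum.inl j) = 0
    · have : ((∏ j, a (Sum.inl j) ^ m (Sum.inl j)) * ∏ j, a (Sum.inr j) ^ m (Sum.inr j)) =
          MvPowerSeries.monomial (m.comapDomain Sum.inr Sum.inr_injective.injOn) (1 : R) := by
        simp [ha, h0, MvPowerSeries.monomial_one_eq, Finsupp.prod_fintype]
      rw [this, MvPowerSeries.coeff_monomial, if_neg, smul_zero]
      intro h
      apply hm
      ext (j | j)
      · rw [hn, h0]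
      · exact (DFunLike.congr_fun h j).symm
    · push Not at h0
      obtain ⟨j, hj⟩ := h0
      rw [Finset.prod_eq_zero (Finset.mem_univ j) (by simp [ha, hj])]
      simp

/-- `F(x, y) ≡ y` modulo every power `𝔪 ^ k` that contains the coordinates of `x`. -/
theorem FormalGroupLaw.sub_mem {p : ℕ} {R : Type*} [CommRing R] [TopologicalSpace R]
    [IsProPDomain p R] {d : ℕ} (F : FormalGroupLaw R d) (i : Fin d) {k : ℕ} {x y : Fin d → R}
    {v : R} (hx : ∀ j, x j ∈ mpow R k) (hv : HasValue (F.toFun i) (Sum.elim x y) v) :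
    v - y i ∈ mpow R k := by
  classical
  have := isTopologicalRing (R := R)
  have hy : HasSum (fun n : Fin d ⊕ Fin d →₀ ℕ =>
      if n = Finsupp.single (Sum.inr i) 1 then y i else 0) (y i) := by
    simpa using hasSum_ite_eq (Finsupp.single (Sum.inr i : Fin d ⊕ Fin d) 1) (y i)
  have hsub := hv.sub hy
  refine (isClosed_mpow (R := R) k).mem_of_tendsto hsub (Filter.Eventually.of_forall fun s => ?_)
  refine Ideal.sum_mem _ fun n _ => ?_
  by_cases hn : ∀ j, n (Sum.inl j) = 0
  · rw [F.coeff_eq i n hn]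
    split_ifs with h
    · subst h
      simp
    · simp
  · have hne : n ≠ Finsupp.single (Sum.inr i) 1 := by
      rintro rfl
      simp at hn
    rw [if_neg hne, sub_zero]
    push Not at hn
    obtain ⟨j, hj⟩ := hn
    apply Ideal.mul_mem_left
    rw [Finsupp.prod_fintype _ _ (by simp), Fintype.prod_sum_type]
    apply Ideal.mul_mem_right
    exact Ideal.mem_of_dvd _ (Finset.dvd_prod_of_mem _ (Finset.mem_univ j))
      (Ideal.pow_mem_of_mem _ (hx j) _ (Nat.pos_of_ne_zero hj))

/-! ### Filtration series and Hausdorff dimension -/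

/-- A filtration series of a topological group: a descending sequence of open subgroups with
trivial intersection. -/
structure FiltrationSeries (G : Type*) [Group G] [TopologicalSpace G] where
  toFun : ℕ → Subgroup G
  antitone : Antitone toFun
  isOpen : ∀ n, IsOpen (toFun n : Set G)
  iInf_eq_bot : ⨅ n, toFun n = ⊥

namespace FiltrationSeries

variable {G : Type*} [Group G] [TopologicalSpace G] (F : FiltrationSeries G)

open Classical in
/-- `d(x, y) = inf {|G : G_n|⁻¹ ∣ x y⁻¹ ∈ G_n}` for `x ≠ y`, and `d(x, x) = 0` (which is also the
value of the infimum when `G` is an infinite profinite group). If `x y⁻¹` lies in no `G_n`, the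
infimum of the empty set is `∞`; this does not influence Hausdorff dimensions. -/
noncomputable def dist (x y : G) : ℝ≥0∞ :=
  if x = y then 0 else ⨅ (n : ℕ) (_ : x * y⁻¹ ∈ F.toFun n), ((F.toFun n).index : ℝ≥0∞)⁻¹

theorem dist_comm (x y : G) : F.dist x y = F.dist y x := by
  have h : ∀ n, x * y⁻¹ ∈ F.toFun n ↔ y * x⁻¹ ∈ F.toFun n := fun n => by
    rw [← inv_mem_iff (x := x * y⁻¹)]
    simp
  by_cases hxy : x = y
  · rw [hxy]
  · simp only [dist, h, if_neg hxy, if_neg (Ne.symm hxy)]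

theorem dist_le_max (x y z : G) : F.dist x z ≤ max (F.dist x y) (F.dist y z) := by
  by_cases hxz : x = z
  · simp [dist, hxz]
  by_cases hxy : x = y
  · subst hxy
    exact le_max_right _ _
  by_cases hyz : y = z
  · subst hyz
    exact le_max_left _ _
  rw [le_max_iff]
  by_contra! hcon
  obtain ⟨h1, h2⟩ := hcon
  rw [dist, if_neg hxy] at h1
  rw [dist, if_neg hyz] at h2
  simp only [iInf_lt_iff] at h1 h2
  obtain ⟨m, hm, h1⟩ := h1
  obtain ⟨n, hn, h2⟩ := h2
  have hmul : x * z⁻¹ = (x * y⁻¹) * (y * z⁻¹) := by group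
  rcases le_total m n with hmn | hmn
  · refine absurd h1 (not_lt.2 ?_)
    rw [dist, if_neg hxz]
    exact iInf₂_le m (hmul ▸ mul_mem hm (F.antitone hmn hn))
  · refine absurd h2 (not_lt.2 ?_)
    rw [dist, if_neg hxz]
    exact iInf₂_le n (hmul ▸ mul_mem (F.antitone hmn hm) hn)

theorem eq_of_dist_eq_zero {x y : G} (h : F.dist x y = 0) : x = y := by
  by_contra hxy
  rw [dist, if_neg hxy] at h
  have hne : x * y⁻¹ ∉ (⊥ : Subgroup G) := by
    rw [Subgroup.mem_bot, mul_inv_eq_one]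
    exact hxy
  rw [← F.iInf_eq_bot, Subgroup.mem_iInf] at hne
  push Not at hne
  obtain ⟨m, hm⟩ := hne
  have hpos : (0 : ℝ≥0∞) < (Finset.range (m + 1)).inf fun n => ((F.toFun n).index : ℝ≥0∞)⁻¹ := by
    rw [Finset.lt_inf_iff (by simp)]
    intro n _
    simp
  refine absurd h (ne_of_gt (lt_of_lt_of_le hpos ?_))
  refine le_iInf₂ fun n hn => Finset.inf_le (Finset.mem_range.2 ?_)
  by_contra hlt
  exact hm (F.antitone (by omega) hn)

/-- The metric on `G` defined by the filtration series. -/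
@[reducible] noncomputable def emetricSpace : EMetricSpace G where
  edist := F.dist
  edist_self x := by simp [dist]
  edist_comm := F.dist_comm
  edist_triangle x y z := (F.dist_le_max x y z).trans (max_le_add_of_nonneg zero_le zero_le)
  eq_of_edist_eq_zero := F.eq_of_dist_eq_zero

/-- The Hausdorff dimension of a subset of `G` with respect to the metric of the filtration. -/
noncomputable def hdim (X : Set G) : ℝ≥0∞ :=
  @dimH G F.emetricSpace X

/-- The Hausdorff spectrum: the set of Hausdorff dimensions of closed subgroups. -/
def hspec : Set ℝ≥0∞ :=
  {α | ∃ H : Subgroup G, IsClosed (H : Set G) ∧ F.hdim (H : Set G) = α}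

end FiltrationSeries

/-! ### `R`-standard groups -/

section Standard

variable (R : Type*) [CommRing R] [TopologicalSpace R] [IsLocalRing R] (d : ℕ)

/-- An `R`-standard structure `(S, φ)` of dimension `d` on the group `S`. -/
structure StandardStructure (S : Type*) [Group S] [TopologicalSpace S] where
  /-- The level `N ≥ 1`. -/
  level : ℕ
  one_le_level : 1 ≤ level
  /-- The formal group law. -/
  law : FormalGroupLaw R d
  /-- The global chart `φ : S → (𝔪 ^ N)^(d)`. -/
  φ : S ≃ₜ {x : Fin d → R // ∀ i, x i ∈ mpow R level}
  map_one : ∀ i, (φ 1).1 i = 0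
  map_mul : ∀ (x y : S) (i : Fin d),
    HasValue (law.toFun i) (Sum.elim (φ x).1 (φ y).1) ((φ (x * y)).1 i)

end Standard

namespace StandardStructure

variable {p : ℕ} {R : Type*} [CommRing R] [TopologicalSpace R] [IsProPDomain p R] {d : ℕ}
  {S : Type*} [Group S] [TopologicalSpace S] (σ : StandardStructure R d S)

/-- The subgroup `S_n = φ⁻¹((𝔪 ^ (N + n))^(d))`. -/
def subgroup (n : ℕ) : Subgroup S where
  carrier := {x | ∀ i, (σ.φ x).1 i ∈ mpow R (σ.level + n)}
  one_mem' i := by rw [σ.map_one]; exact zero_mem _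
  mul_mem' {x y} hx hy i := by
    have := add_mem (σ.law.sub_mem i hx (σ.map_mul x y i)) (hy i)
    simpa using this
  inv_mem' {x} hx i := by
    have := σ.law.sub_mem i hx (σ.map_mul x x⁻¹ i)
    rw [mul_inv_cancel, σ.map_one, zero_sub] at this
    simpa using this

/-- The `R`-standard filtration `{S_n}` of the `R`-standard group `(S, φ)`. -/
def filtration : FiltrationSeries S where
  toFun := σ.subgroup
  antitone m n hmn x hx i := Ideal.pow_le_pow_right (by omega) (hx i)
  isOpen n := by
    have : ((σ.subgroup n : Subgroup S) : Set S) =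
        ⋂ i, (fun x => (σ.φ x).1 i) ⁻¹' (mpow R (σ.level + n) : Set R) := by
      ext x
      simp [subgroup]
    rw [this]
    refine isOpen_iInter_of_finite fun i => (isOpen_mpow _).preimage ?_
    exact (continuous_apply i).comp (continuous_subtype_val.comp σ.φ.continuous)
  iInf_eq_bot := by
    rw [eq_bot_iff]
    intro x hx
    rw [Subgroup.mem_iInf] at hx
    rw [Subgroup.mem_bot]
    apply σ.φ.injective
    ext i
    rw [σ.map_one]
    exact eq_zero_of_forall_mem_mpow fun k => Ideal.pow_le_pow_right (by omega) (hx k i)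

end StandardStructure

/-! ### `R`-analytic groups and their standard Hausdorff spectrum -/

section Analytic

variable (R : Type*) [CommRing R] [TopologicalSpace R] [IsLocalRing R] (d : ℕ)
  (G : Type*) [Group G] [TopologicalSpace G]

variable {R d G} in
/-- The change of charts from `e` to `e'` is `R`-analytic at every point where it is defined. -/
def AnalyticChange (e e' : OpenPartialHomeomorph G (Fin d → R)) : Prop :=
  ∀ u ∈ (e.symm.trans e').source, RAnalyticAt (fun v => e' (e.symm v)) u

/-- An `R`-analytic group of dimension `d`: the charts of the atlas, which take values in `R^(d)`,
are `R`-analytically compatible, and multiplication and inversion are `R`-analytic. -/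
structure IsAnalyticGroup [ChartedSpace (Fin d → R) G] : Prop where
  compatible : ∀ e ∈ atlas (Fin d → R) G, ∀ e' ∈ atlas (Fin d → R) G, AnalyticChange e e'
  analytic_mul : ∀ e ∈ atlas (Fin d → R) G, ∀ e' ∈ atlas (Fin d → R) G,
    ∀ e'' ∈ atlas (Fin d → R) G, ∀ g ∈ e.source, ∀ h ∈ e'.source, g * h ∈ e''.source →
      RAnalyticAt (fun u : Fin d ⊕ Fin d → R =>
        e'' (e.symm (fun i => u (Sum.inl i)) * e'.symm (fun i => u (Sum.inr i))))
        (Sum.elim (e g) (e' h))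
  analytic_inv : ∀ e ∈ atlas (Fin d → R) G, ∀ e' ∈ atlas (Fin d → R) G,
    ∀ g ∈ e.source, g⁻¹ ∈ e'.source → RAnalyticAt (fun u => e' (e.symm u)⁻¹) (e g)

/-- An open `R`-standard subgroup `(S, φ)` of the `R`-analytic group `G`: an open subgroup with an
`R`-standard structure whose `φ` is a chart of the manifold `G`. -/
structure OpenStandardSubgroup [ChartedSpace (Fin d → R) G] where
  S : Subgroup G
  isOpen : IsOpen (S : Set G)
  std : StandardStructure R d S
  /-- `φ` regarded as a chart of `G` with domain `S`. -/
  chart : OpenPartialHomeomorph G (Fin d → R)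
  chart_source : chart.source = (S : Set G)
  chart_eq : ∀ x : S, chart x = (std.φ x).1
  chart_compatible : ∀ e ∈ atlas (Fin d → R) G, AnalyticChange e chart ∧ AnalyticChange chart e

end Analytic

section Spectrum

variable {p : ℕ} {R : Type*} [CommRing R] [TopologicalSpace R] [IsProPDomain p R] {d : ℕ}
  {G : Type*} [Group G] [TopologicalSpace G] [ChartedSpace (Fin d → R) G]

/-- The `R`-standard filtration of `G` induced by the open `R`-standard subgroup `(S, φ)`: the
subgroups `S_n = φ⁻¹((𝔪 ^ (N + n))^(d))`, as subgroups of `G`. -/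
def OpenStandardSubgroup.filtration (T : OpenStandardSubgroup R d G) : FiltrationSeries G where
  toFun n := (T.std.filtration.toFun n).map T.S.subtype
  antitone _ _ hmn := Subgroup.map_mono (T.std.filtration.antitone hmn)
  isOpen n := by
    rw [Subgroup.coe_map]
    exact T.isOpen.isOpenMap_subtype_val _ (T.std.filtration.isOpen n)
  iInf_eq_bot := by
    rw [← Subgroup.map_iInf _ T.S.subtype_injective, T.std.filtration.iInf_eq_bot,
      Subgroup.map_bot]

variable (R d) in
/-- `α` is the `R`-standard Hausdorff dimension of `X ⊆ G`: there are `R`-standard filtrations of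
`G`, and with respect to every one of them `X` has Hausdorff dimension `α`. -/
def IsStandardHdim (X : Set G) (α : ℝ≥0∞) : Prop :=
  Nonempty (OpenStandardSubgroup R d G) ∧
    ∀ T : OpenStandardSubgroup R d G, T.filtration.hdim X = α

variable (R d G) in
/-- The `R`-standard Hausdorff spectrum of `G`: the set of `R`-standard Hausdorff dimensions of
closed subgroups of `G`. -/
def standardHspec : Set ℝ≥0∞ :=
  {α | ∃ H : Subgroup G, IsClosed (H : Set G) ∧ IsStandardHdim R d (H : Set G) α}

end Spectrum

end RAnalytic

namespace RAnalytic

/-! ### Compactness of the coefficient ring and its maximal-ideal filtration -/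

section Ring

variable {p : ℕ} {R : Type*} [CommRing R] [TopologicalSpace R] [IsProPDomain p R]

/-! For a closed subgroup `H` of a compact abelian group `G`, the Hausdorff dimension is the lower
limit of log |H : H ∩ G_n| / log |G : G_n|: cosets give the upper bound (`hdim_le`), Haar measure on
`H` the lower one (`le_hdim`). The spectrum is thus a question about the growth of indices.

A formal group law is addition up to mixed terms, so for `x` in `S_n` the coordinates of `x ^ p`
agree with `p` times those of `x` modulo 𝔪^(2(N+n)). In characteristic `p` this puts `x ^ p` in
`S_(2n+1)`, hence `x ^ p ^ c` in `S_(2^c-1)` for every `x`. A subgroup with `r` generators therefore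
has index at most p^(cr) at level 2^c - 1, polynomial in the level, while |S : S_n| ≥ 2^n. Finitely
generated subgroups are negligible (`IsSlowSeries.relIndex_lt`).

Given 0 < α ≤ 1, a chain of finitely generated subgroups is built greedily
(`exists_subgroup_growth`). Elements are added only when the index at the next level would fall
below |S : S_n|^α, and only until that threshold is passed, with an overshoot of at most a factor
`p`. Slow growth forces additions infinitely often, so the limit of the chain has dimension exactly
α.

For an analytic group, changes of charts preserve congruences modulo high powers of 𝔪, so any two
standard filtrations eventually coincide after a shift (`exists_filtration_le`), which does not
affect the lower limit. An open standard subgroup exists because the group axioms, valid at all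
points near 1, become identities of power series (`eq_zero_of_hasValue_zero`). -/

theorem mpow_antitone {m n : ℕ} (h : m ≤ n) : mpow R n ≤ mpow R m := Ideal.pow_le_pow_right h

theorem hasBasis_nhds_zero : (𝓝 (0 : R)).HasBasis (fun _ => True) fun n => (mpow R n : Set R) :=
  (IsProPDomain.isAdic (R := R)).hasBasis_nhds_zero

theorem isLinearTopology {p : ℕ} {R : Type*} [CommRing R] [TopologicalSpace R]
    [IsProPDomain p R] : IsLinearTopology R R :=
  IsLinearTopology.mk_of_hasBasis R (hasBasis_nhds_zero (R := R))

theorem t2Space {p : ℕ} {R : Type*} [CommRing R] [TopologicalSpace R]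
    [IsProPDomain p R] : T2Space R := by
  have := IsProPDomain.isAdicComplete (R := R)
  exact (IsProPDomain.isAdic (R := R)).isHausdorff_iff.1 inferInstance

theorem finite_quotient_mpow (n : ℕ) : Finite (R ⧸ mpow R n) := by
  have := IsProPDomain.finite_residueField (R := R)
  exact IsLocalRing.finite_quotient_iff.2 ⟨n, le_rfl⟩

/-- Completeness together with total boundedness, the latter from the finiteness of all quotients by
powers of 𝔪. -/
theorem compactSpace {p : ℕ} {R : Type*} [CommRing R] [TopologicalSpace R]
    [IsProPDomain p R] : CompactSpace R := by
  have := isTopologicalRing (R := R)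
  have := IsProPDomain.isAdicComplete (R := R)
  let _ : UniformSpace R := IsTopologicalAddGroup.rightUniformSpace R
  have : IsUniformAddGroup R := isUniformAddGroup_of_addCommGroup
  have hc : CompleteSpace R :=
    ((IsProPDomain.isAdic (R := R)).isAdicComplete_iff.1 inferInstance).1
  refine ⟨isCompact_iff_totallyBounded_isComplete.2 ⟨?_, completeSpace_iff_isComplete_univ.1 hc⟩⟩
  rw [totallyBounded_iff_subset_finite_iUnion_nhds_zero]
  intro U hU
  obtain ⟨n, -, hn⟩ := (hasBasis_nhds_zero (R := R)).mem_iff.1 hU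
  have := finite_quotient_mpow (R := R) n
  refine ⟨Set.range (Quotient.out : R ⧸ mpow R n → R), Set.finite_range _, fun x _ => ?_⟩
  simp only [Set.mem_iUnion]
  refine ⟨_, ⟨Ideal.Quotient.mk _ x, rfl⟩, x - (Ideal.Quotient.mk (mpow R n) x).out, ?_, ?_⟩
  · apply hn
    rw [SetLike.mem_coe, ← Ideal.Quotient.eq]
    exact (Quotient.out_eq _).symm
  · simp

/-- By Nakayama, 𝔪^n = 𝔪^(n+1) would force 𝔪^n = 0, but `t ^ n` is nonzero in a domain. This makes
standard filtrations strictly descending. -/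
theorem exists_mem_mpow_not_mem_succ {t : R} (ht : t ∈ IsLocalRing.maximalIdeal R) (h0 : t ≠ 0)
    (n : ℕ) : ∃ x ∈ mpow R n, x ∉ mpow R (n + 1) := by
  by_contra! hcon
  have h1 : mpow R n ≤ IsLocalRing.maximalIdeal R • mpow R n := fun x hx => by
    simpa [mpow, pow_succ'] using hcon x hx
  have h2 : mpow R n = ⊥ := Submodule.eq_bot_of_le_smul_of_le_jacobson_bot _ _
    (IsNoetherian.noetherian _) h1 (IsLocalRing.jacobson_eq_maximalIdeal ⊥ bot_ne_top).ge
  have h3 : t ^ n ∈ mpow R n := Ideal.pow_mem_pow ht n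
  rw [h2, Ideal.mem_bot] at h3
  exact pow_ne_zero _ h0 h3

theorem infinite_of_mem_maximalIdeal {t : R} (ht : t ∈ IsLocalRing.maximalIdeal R) (h0 : t ≠ 0) :
    Infinite R := by
  by_contra h
  rw [not_infinite_iff_finite] at h
  have hu : IsUnit t := (Finite.isField_of_domain R).mul_inv_cancel h0 |>.elim
    fun b hb => IsUnit.of_mul_eq_one b hb
  exact (IsLocalRing.mem_maximalIdeal t).1 ht hu

end Ring

/-! ### Values of power series: congruences, substitution, identity theorem -/

section Value

variable {p : ℕ} {R : Type*} [CommRing R] [TopologicalSpace R] [IsProPDomain p R]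
  {ι κ : Type*}

theorem HasValue.unique {p : ℕ} {R : Type*} [CommRing R] [TopologicalSpace R]
    [IsProPDomain p R] {ι : Type*} {F : MvPowerSeries ι R} {x : ι → R} {v w : R} (hv : HasValue F x v)
    (hw : HasValue F x w) : v = w := by
  have := t2Space (R := R)
  exact HasSum.unique hv hw

theorem HasValue.sub {p : ℕ} {R : Type*} [CommRing R] [TopologicalSpace R]
    [IsProPDomain p R] {ι : Type*} {F G : MvPowerSeries ι R} {x : ι → R} {v w : R} (hv : HasValue F x v)
    (hw : HasValue G x w) : HasValue (F - G) x (v - w) := by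
  have := isTopologicalRing (R := R)
  have := HasSum.sub hv hw
  simpa [HasValue, sub_mul] using this

/-- Monomials respect congruences modulo 𝔪^k, and the estimate passes to the limit because 𝔪^k is
closed. Coefficients in `R` mean that no depth is lost. -/
theorem HasValue.sub_mem {F : MvPowerSeries ι R} {x y : ι → R} {v w : R} {k : ℕ}
    (hv : HasValue F x v) (hw : HasValue F y w) (hxy : ∀ i, x i - y i ∈ mpow R k) :
    v - w ∈ mpow R k := by
  have := isTopologicalRing (R := R)
  refine (isClosed_mpow (R := R) k).mem_of_tendsto (HasSum.sub hv hw)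
    (Filter.Eventually.of_forall fun s => ?_)
  refine Ideal.sum_mem _ fun n _ => ?_
  rw [← mul_sub]
  apply Ideal.mul_mem_left
  rw [← Ideal.Quotient.eq, map_finsuppProd, map_finsuppProd]
  refine Finsupp.prod_congr fun i _ => ?_
  rw [map_pow, map_pow, Ideal.Quotient.eq.2 (hxy i)]

theorem hasValue_C (c : R) (x : ι → R) : HasValue (MvPowerSeries.C c) x c := by
  classical
  have : HasValue (MvPowerSeries.C c) x ((fun n : ι →₀ ℕ =>
      MvPowerSeries.coeff n (MvPowerSeries.C c) * n.prod fun i k => x i ^ k) 0) :=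
    hasSum_single 0 fun n hn => by simp [MvPowerSeries.coeff_C, hn]
  simpa using this

theorem hasValue_zero_point (F : MvPowerSeries ι R) :
    HasValue F 0 (MvPowerSeries.constantCoeff F) := by
  classical
  have : HasValue F 0 ((fun n : ι →₀ ℕ =>
      MvPowerSeries.coeff n F * n.prod fun i k => (0 : ι → R) i ^ k) 0) :=
    hasSum_single 0 fun n hn => by
      obtain ⟨i, hi⟩ := Finsupp.ne_iff.1 hn
      simp only [Pi.zero_apply]
      rw [Finsupp.prod, Finset.prod_eq_zero (i := i) (by simpa using hi) (zero_pow (by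
        simpa using hi)), mul_zero]
  simpa using this

theorem hasValue_X (i : ι) (x : ι → R) : HasValue (MvPowerSeries.X i) x (x i) := by
  classical
  have : HasValue (MvPowerSeries.X i) x ((fun n : ι →₀ ℕ =>
      MvPowerSeries.coeff n (MvPowerSeries.X i : MvPowerSeries ι R) * n.prod fun i k => x i ^ k)
      (Finsupp.single i 1)) :=
    hasSum_single _ fun n hn => by simp [MvPowerSeries.coeff_X, hn]
  simpa using this

theorem hasValue_zero (x : ι → R) : HasValue (0 : MvPowerSeries ι R) x 0 := by
  simpa using hasValue_C (0 : R) x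

theorem hasEval_of_mem [Finite ι] {x : ι → R} (hx : ∀ i, x i ∈ IsLocalRing.maximalIdeal R) :
    MvPowerSeries.HasEval x where
  hpow i := by
    refine (hasBasis_nhds_zero (R := R)).tendsto_right_iff.2 fun n _ => ?_
    filter_upwards [Filter.eventually_ge_atTop n] with k hk
    exact mpow_antitone hk (Ideal.pow_mem_pow (hx i) k)
  tendsto_zero := by simp

end Value

/-- Used with `A = T = R`. The two rings are kept apart so that the coefficients can carry the
discrete uniformity while the values keep their own topology. -/
theorem hasSum_subst {A T σ τ : Type*} [CommRing A] [CommRing T] [Algebra A T]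
    [TopologicalSpace T] [IsTopologicalRing T] [IsLinearTopology T T] [CompactSpace T] [T2Space T]
    {a : σ → MvPowerSeries τ A} (ha : MvPowerSeries.HasSubst a) {x : τ → T}
    (hx : MvPowerSeries.HasEval x) {v : σ → T}
    (hv : ∀ s, HasSum (fun n : τ →₀ ℕ =>
      algebraMap A T (MvPowerSeries.coeff n (a s)) * n.prod fun i k => x i ^ k) (v s))
    (hev : MvPowerSeries.HasEval v) (f : MvPowerSeries σ A) {w : T}
    (hw : HasSum (fun n : σ →₀ ℕ =>
      algebraMap A T (MvPowerSeries.coeff n f) * n.prod fun i k => v i ^ k) w) :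
    HasSum (fun n : τ →₀ ℕ => algebraMap A T (MvPowerSeries.coeff n (MvPowerSeries.subst a f)) *
      n.prod fun i k => x i ^ k) w := by
  let _ : UniformSpace A := ⊥
  have : DiscreteUniformity A := ⟨rfl⟩
  let _ : UniformSpace T := IsTopologicalAddGroup.rightUniformSpace T
  have : IsUniformAddGroup T := isUniformAddGroup_of_addCommGroup
  have hcont : Continuous (algebraMap A T) := continuous_of_discreteTopology
  have key := MvPowerSeries.eval₂_subst (T := T) ha hx f
  have hv' : (fun s => MvPowerSeries.eval₂ (algebraMap A T) x (a s)) = v := by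
    funext s
    exact (MvPowerSeries.hasSum_eval₂ hcont hx (a s)).unique (hv s)
  rw [hv', (MvPowerSeries.hasSum_eval₂ hcont hev f).unique hw] at key
  rw [← key]
  exact MvPowerSeries.hasSum_eval₂ hcont hx _

section Value

variable {p : ℕ} {R : Type*} [CommRing R] [TopologicalSpace R] [IsProPDomain p R]
  {ι κ : Type*}

theorem HasValue.subst [Finite ι] [Finite κ] {F : MvPowerSeries ι R}
    {a : ι → MvPowerSeries κ R} {x : κ → R} {v : ι → R} {w : R}
    (hw : HasValue F v w) (hv : ∀ i, HasValue (a i) x (v i))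
    (ha : ∀ i, MvPowerSeries.constantCoeff (a i) = 0)
    (hx : ∀ i, x i ∈ IsLocalRing.maximalIdeal R) :
    HasValue (MvPowerSeries.subst a F) x w := by
  have := isTopologicalRing (R := R)
  have := isLinearTopology (R := R)
  have := compactSpace (R := R)
  have := t2Space (R := R)
  have hvm : ∀ i, v i ∈ IsLocalRing.maximalIdeal R := fun i => by
    have h := (hv i).sub_mem (k := 1) (hasValue_zero_point (a i)) (by simpa using hx)
    simpa [ha] using h
  exact hasSum_subst (A := R) (T := R) (MvPowerSeries.hasSubst_of_constantCoeff_zero ha)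
    (hasEval_of_mem hx) hv (hasEval_of_mem hvm) F hw

/-- The ideal is a continuous image of the compact ring. Bounding tails of series in principal
ideals, rather than in powers of 𝔪, allows division by powers of `t` afterwards. -/
theorem isClosed_span_singleton {p : ℕ} {R : Type*} [CommRing R] [TopologicalSpace R]
    [IsProPDomain p R] (b : R) : IsClosed (Ideal.span {b} : Set R) := by
  have := isTopologicalRing (R := R)
  have := compactSpace (R := R)
  have := t2Space (R := R)
  have h : (Ideal.span {b} : Set R) = (fun r => b * r) '' Set.univ := by
    ext y
    simp [Ideal.mem_span_singleton, Dvd.dvd, eq_comm]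
  rw [h]
  exact (isCompact_univ.image (continuous_const_mul b)).isClosed

/-- A power series all of whose values on some `(𝔪 ^ N)^ι` vanish is zero. -/
theorem eq_zero_of_hasValue_zero [Finite ι] {t : R} (ht : t ∈ IsLocalRing.maximalIdeal R)
    (ht0 : t ≠ 0) {f : MvPowerSeries ι R} {N : ℕ}
    (hf : ∀ x : ι → R, (∀ i, x i ∈ mpow R N) → HasValue f x 0) : f = 0 := by
  classical
  have := Fintype.ofFinite ι
  have := isTopologicalRing (R := R)
  have := infinite_of_mem_maximalIdeal ht ht0
  by_contra hne
  have hex : ∃ D, ∃ n : ι →₀ ℕ, (∑ i, n i) = D ∧ MvPowerSeries.coeff n f ≠ 0 := by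
    by_contra! h
    exact hne (MvPowerSeries.ext fun n => by simpa using h _ n rfl)
  set D := Nat.find hex with hD
  obtain ⟨n₀, hn₀, hn₀f⟩ := Nat.find_spec hex
  have hmin : ∀ n : ι →₀ ℕ, (∑ i, n i) < D → MvPowerSeries.coeff n f = 0 := fun n hn => by
    by_contra h
    exact Nat.find_min hex hn ⟨n, rfl, h⟩
  set A : Finset (ι →₀ ℕ) := Finset.finsuppAntidiag Finset.univ D with hA
  have hmemA : ∀ n : ι →₀ ℕ, n ∈ A ↔ (∑ i, n i) = D := fun n => by
    simp [hA, Finset.mem_finsuppAntidiag]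
  -- `P` is the nonzero homogeneous part of `f` of least degree `D`. As `R` is an infinite domain, a
  -- contradiction follows once `P` vanishes at every point of `R^ι`, however large.
  set P : MvPolynomial ι R := ∑ n ∈ A, MvPolynomial.monomial n (MvPowerSeries.coeff n f) with hP
  have hPne : P ≠ 0 := by
    intro h
    have := congrArg (MvPolynomial.coeff n₀) h
    rw [hP, MvPolynomial.coeff_sum] at this
    simp [MvPolynomial.coeff_monomial, hmemA, ← hD, hn₀] at this
    exact hn₀f this
  apply hPne
  apply MvPolynomial.funext
  intro a
  rw [map_zero]
  have hPa : MvPolynomial.eval a P = ∑ n ∈ A, MvPowerSeries.coeff n f * n.prod fun i k => a i ^ k := by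
    simp [hP, MvPolynomial.eval_monomial]
  have hterm : ∀ (k : ℕ) (n : ι →₀ ℕ), (n.prod fun i e => (t ^ k * a i) ^ e) =
      t ^ (k * ∑ i, n i) * n.prod fun i e => a i ^ e := fun k n => by
    rw [Finsupp.prod_fintype _ _ (by simp), Finsupp.prod_fintype _ _ (by simp)]
    simp only [mul_pow, Finset.prod_mul_distrib, ← pow_mul, Finset.prod_pow_eq_pow_sum]
    rw [Finset.mul_sum]
  -- At the small point `t ^ k * a`, the part of degree `D` contributes `t ^ (k * D) * P(a)` and all
  -- the rest is divisible by `t ^ (k * (D + 1))`. As the total is 0, `t ^ k` divides `P(a)`.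
  have key : ∀ k, N ≤ k → MvPolynomial.eval a P ∈ mpow R k := by
    intro k hk
    have h0 := hf (fun i => t ^ k * a i) fun i =>
      Ideal.mul_mem_right _ _ (mpow_antitone hk (Ideal.pow_mem_pow ht k))
    have h1 : 0 - t ^ (k * D) * MvPolynomial.eval a P ∈ Ideal.span {t ^ (k * (D + 1))} := by
      refine (isClosed_span_singleton (t ^ (k * (D + 1)))).mem_of_tendsto
        (Filter.Tendsto.sub_const (show Filter.Tendsto _ _ _ from h0)
          (t ^ (k * D) * MvPolynomial.eval a P)) ?_
      filter_upwards [Filter.eventually_ge_atTop A] with s hs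
      have h2 : t ^ (k * D) * MvPolynomial.eval a P = ∑ n ∈ A, MvPowerSeries.coeff n f *
          n.prod fun i e => (t ^ k * a i) ^ e := by
        rw [hPa, Finset.mul_sum]
        refine Finset.sum_congr rfl fun n hn => ?_
        rw [hterm, (hmemA n).1 hn]
        ring
      rw [h2, ← Finset.sum_sdiff hs, add_sub_cancel_right]
      refine Ideal.sum_mem _ fun n hn => ?_
      rw [Finset.mem_sdiff, hmemA] at hn
      rcases lt_or_gt_of_ne hn.2 with hlt | hgt
      · simp [hmin n hlt]
      · rw [hterm]
        apply Ideal.mul_mem_left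
        apply Ideal.mul_mem_right
        rw [Ideal.mem_span_singleton]
        exact pow_dvd_pow _ (Nat.mul_le_mul_left _ hgt)
    rw [zero_sub, neg_mem_iff, Ideal.mem_span_singleton] at h1
    obtain ⟨r, hr⟩ := h1
    have : MvPolynomial.eval a P = t ^ k * r := by
      apply mul_left_cancel₀ (pow_ne_zero (k * D) ht0)
      rw [hr]
      ring
    rw [this]
    exact Ideal.mul_mem_right _ _ (Ideal.pow_mem_pow ht k)
  exact eq_zero_of_forall_mem_mpow fun k =>
    mpow_antitone (le_max_right N k) (key _ (le_max_left _ _))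

theorem eq_of_hasValue_eq [Finite ι] {t : R} (ht : t ∈ IsLocalRing.maximalIdeal R)
    (ht0 : t ≠ 0) {f g : MvPowerSeries ι R} {N : ℕ}
    (hfg : ∀ x : ι → R, (∀ i, x i ∈ mpow R N) → ∃ v, HasValue f x v ∧ HasValue g x v) :
    f = g := by
  refine sub_eq_zero.1 (eq_zero_of_hasValue_zero ht ht0 (N := N) fun x hx => ?_)
  obtain ⟨v, h1, h2⟩ := hfg x hx
  simpa using h1.sub h2

end Value

/-! ### Mass distribution via Haar measure -/

section Mass

open MeasureTheory

/-- A mass distribution principle for closed subgroups of compact abelian groups. -/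
theorem one_le_hausdorffMeasure_subgroup {G : Type*} [CommGroup G] [EMetricSpace G]
    [IsTopologicalGroup G] [CompactSpace G] [MeasurableSpace G] [BorelSpace G]
    {F : ℕ → Subgroup G} (hF : ∀ n, IsOpen (F n : Set G)) {H : Subgroup G}
    (hH : IsClosed (H : Set G)) {s : ℝ} {ε : ℝ≥0∞} (hε : 0 < ε)
    (hU : ∀ (U : Set G) (x : G), x ∈ U → Metric.ediam U ≤ ε → ∀ c, Metric.ediam U ^ s < c →
      ∃ n, (∀ y ∈ U, y * x⁻¹ ∈ F n) ∧ (((F n).relIndex H : ℕ) : ℝ≥0∞)⁻¹ ≤ c) :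
    1 ≤ Measure.hausdorffMeasure s (H : Set G) := by
  have : CompactSpace H := isCompact_iff_compactSpace.1 hH.isCompact
  let _ : MeasurableSpace H := borel H
  have : BorelSpace H := ⟨rfl⟩
  let ν : Measure H := Measure.haarMeasure ⊤
  have hν : ν Set.univ = 1 := by
    simpa using Measure.haarMeasure_self (K₀ := (⊤ : TopologicalSpace.PositiveCompacts H))
  have hval : Measurable (Subtype.val : H → G) := continuous_subtype_val.measurable
  -- A coset of `F n` that meets `H` meets it in a translate of `H ∩ F n`, whose Haar mass is the
  -- inverse of its index in `H`.
  have hcoset : ∀ (n : ℕ) (x : G), ν (Subtype.val ⁻¹' {y : G | y * x⁻¹ ∈ F n}) ≤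
      (((F n).relIndex H : ℕ) : ℝ≥0∞)⁻¹ := by
    intro n x
    rcases Set.eq_empty_or_nonempty (Subtype.val ⁻¹' {y : G | y * x⁻¹ ∈ F n} : Set H) with he | ⟨h, hh⟩
    · simp [he]
    have hopen : IsOpen (((F n).subgroupOf H : Subgroup H) : Set H) :=
      (hF n).preimage continuous_subtype_val
    have hfin := Subgroup.quotient_finite_of_isOpen _ hopen
    have hfi : ((F n).subgroupOf H).FiniteIndex := Subgroup.finiteIndex_of_finite_quotient
    have hmul := Subgroup.index_mul_measure ((F n).subgroupOf H) hopen.measurableSet ν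
    rw [hν] at hmul
    have hset : (Subtype.val ⁻¹' {y : G | y * x⁻¹ ∈ F n} : Set H) =
        (fun z => h⁻¹ * z) ⁻¹' (((F n).subgroupOf H : Subgroup H) : Set H) := by
      ext z
      simp only [Set.mem_preimage, Set.mem_ofPred_eq, SetLike.mem_coe, Subgroup.mem_subgroupOf,
        Subgroup.coe_mul, Subgroup.coe_inv] at hh ⊢
      have he : (z : G) * x⁻¹ = ((h : G)⁻¹ * z) * (h * x⁻¹) := by
        rw [mul_comm (h : G)⁻¹, mul_assoc, inv_mul_cancel_left]
      rw [he]
      exact Subgroup.mul_mem_cancel_right _ hh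
    rw [hset, measure_preimage_mul]
    exact (ENNReal.eq_inv_of_mul_eq_one_left ((mul_comm _ _).trans hmul)).le
  have hle : ν.map Subtype.val ≤ Measure.hausdorffMeasure s := by
    refine Measure.le_hausdorffMeasure s _ ε hε fun U hUε => ?_
    rcases U.eq_empty_or_nonempty with rfl | ⟨x, hx⟩
    · simp
    -- Bounds strictly above the `s`-th power of the diameter are used because a set of diameter 0
    -- lies in cosets of every depth, none of which need have mass 0.
    refine le_of_forall_gt fun c hc => ?_
    obtain ⟨c', hc', hc'c⟩ := exists_between hc
    obtain ⟨n, hn, hnc⟩ := hU U x hx hUε c' hc'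
    have hmeas : MeasurableSet {y : G | y * x⁻¹ ∈ F n} :=
      ((hF n).preimage (continuous_mul_const x⁻¹)).measurableSet
    calc ν.map Subtype.val U ≤ ν.map Subtype.val {y : G | y * x⁻¹ ∈ F n} := measure_mono hn
      _ = ν (Subtype.val ⁻¹' {y : G | y * x⁻¹ ∈ F n}) := Measure.map_apply hval hmeas
      _ ≤ c' := (hcoset n x).trans hnc
      _ < c := hc'c
  calc (1 : ℝ≥0∞) = ν.map Subtype.val (H : Set G) := by
        rw [Measure.map_apply hval hH.measurableSet]
        rw [← hν]
        congr 1
        ext z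
        simp
    _ ≤ _ := hle _

end Mass

/-! ### Hausdorff dimension in terms of indices -/

namespace FiltrationSeries

open Filter

/-- The terms are closed as well as open, so by compactness a descending sequence with trivial
intersection enters every neighbourhood of 1. -/
theorem hasBasis_nhds_one {G : Type*} [Group G] [TopologicalSpace G] [IsTopologicalGroup G]
    [CompactSpace G] (F : FiltrationSeries G) :
    (𝓝 (1 : G)).HasBasis (fun _ => True) fun n => (F.toFun n : Set G) := by
  refine ⟨fun U => ⟨fun hU => ?_, fun ⟨n, _, hn⟩ =>
    mem_of_superset ((F.isOpen n).mem_nhds (one_mem _)) hn⟩⟩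
  have hclosed : ∀ n, IsClosed (F.toFun n : Set G) := fun n =>
    (F.toFun n).isClosed_of_isOpen (F.isOpen n)
  obtain ⟨n, hn⟩ := exists_subset_nhds_of_isCompact' (V := fun n => (F.toFun n : Set G))
    (directed_of_isDirected_le fun m n h => F.antitone h) (fun n => (hclosed n).isCompact)
    hclosed (U := U) fun x hx => by
      have hx1 : x ∈ (⨅ n, F.toFun n) := by simpa [Subgroup.mem_iInf] using hx
      rw [F.iInf_eq_bot, Subgroup.mem_bot] at hx1
      rwa [hx1]
  exact ⟨n, trivial, hn⟩

variable {G : Type*} [CommGroup G] [TopologicalSpace G]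

theorem dist_le_of_mem (F : FiltrationSeries G) {x y : G} {n : ℕ} (h : x * y⁻¹ ∈ F.toFun n) :
    F.dist x y ≤ ((F.toFun n).index : ℝ≥0∞)⁻¹ := by
  rw [dist]
  split_ifs
  · exact zero_le
  · exact iInf₂_le n h

theorem mem_of_dist_lt (F : FiltrationSeries G) {x y : G} {n : ℕ}
    (hfin : ∀ n, (F.toFun n).index ≠ 0)
    (h : F.dist x y < ((F.toFun n).index : ℝ≥0∞)⁻¹) : x * y⁻¹ ∈ F.toFun n := by
  by_cases hxy : x = y
  · simp [hxy]
  rw [dist, if_neg hxy] at h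
  simp only [iInf_lt_iff] at h
  obtain ⟨m, hm, hlt⟩ := h
  rw [ENNReal.inv_lt_inv, Nat.cast_lt] at hlt
  refine F.antitone (le_of_not_gt fun hmn => ?_) hm
  exact absurd (Nat.le_of_dvd (Nat.pos_of_ne_zero (hfin n))
    (Subgroup.index_dvd_of_le (F.antitone hmn.le))) (not_le.2 hlt)

theorem tendsto_inv_index (F : FiltrationSeries G)
    (hF : Tendsto (fun n => (F.toFun n).index) atTop atTop) :
    Tendsto (fun n => ((F.toFun n).index : ℝ≥0∞)⁻¹) atTop (𝓝 0) :=
  ENNReal.tendsto_inv_nat_nhds_zero.comp hF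

theorem index_ne_zero [IsTopologicalGroup G] [CompactSpace G] (F : FiltrationSeries G) (n : ℕ) :
    (F.toFun n).index ≠ 0 := by
  have := Subgroup.quotient_finite_of_isOpen _ (F.isOpen n)
  exact Subgroup.index_ne_zero_of_finite

/-- Balls and cosets of the series are cofinal in each other, since the indices tend to infinity.
Compactness and Haar measure thus become available for the metric in which the dimension is
computed. -/
theorem emetricSpace_toTopologicalSpace [IsTopologicalGroup G] [CompactSpace G]
    (F : FiltrationSeries G) (hF : Tendsto (fun n => (F.toFun n).index) atTop atTop) :
    F.emetricSpace.toUniformSpace.toTopologicalSpace = ‹TopologicalSpace G› := by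
  refine TopologicalSpace.ext_nhds fun x => ?_
  have h1 : (𝓝 x).HasBasis (fun _ => True) fun n => {y | y * x⁻¹ ∈ F.toFun n} := by
    have := F.hasBasis_nhds_one.comap fun y => y * x⁻¹
    rwa [nhds_translation_mul_inv] at this
  have h2 := @Metric.nhds_basis_eball G F.emetricSpace.toPseudoEMetricSpace x
  refine h2.ext h1 (fun ε hε => ?_) fun n _ => ?_
  · obtain ⟨n, hn⟩ := ((F.tendsto_inv_index hF).eventually_lt_const hε).exists
    exact ⟨n, trivial, fun y hy => (F.dist_le_of_mem hy).trans_lt hn⟩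
  · exact ⟨((F.toFun n).index : ℝ≥0∞)⁻¹, by simp, fun y hy => F.mem_of_dist_lt F.index_ne_zero hy⟩

theorem relIndex_ne_zero [IsTopologicalGroup G] [CompactSpace G] (F : FiltrationSeries G) (n : ℕ)
    (H : Subgroup G) : (F.toFun n).relIndex H ≠ 0 := fun h =>
  F.index_ne_zero n (Subgroup.index_eq_zero_of_relIndex_eq_zero h)

/-- A set of small diameter δ lies in a coset whose Haar mass in `H` is at most δ^s, so the mass
distribution principle bounds the `s`-dimensional measure of `H` below by 1. -/
theorem le_hdim [IsTopologicalGroup G] [CompactSpace G]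
    (F : FiltrationSeries G) (hF : Tendsto (fun n => (F.toFun n).index) atTop atTop)
    {H : Subgroup G} (hH : IsClosed (H : Set G)) {s : NNReal}
    (h : ∀ᶠ n in atTop, ((F.toFun n).index : ℝ) ^ (s : ℝ) ≤ (F.toFun n).relIndex H) :
    (s : ℝ≥0∞) ≤ F.hdim (H : Set G) := by
  rcases eq_or_ne s 0 with rfl | hs
  · simp
  have hs0 : (0 : ℝ) < s := by positivity
  obtain ⟨n₀, hn₀⟩ := eventually_atTop.1 h
  have hpow : ∀ n, n₀ ≤ n → (((F.toFun n).relIndex H : ℕ) : ℝ≥0∞)⁻¹ ≤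
      (((F.toFun n).index : ℝ≥0∞)⁻¹) ^ (s : ℝ) := fun n hn => by
    rw [ENNReal.inv_rpow, ENNReal.inv_le_inv]
    have h1 : ((F.toFun n).index : NNReal) ^ (s : ℝ) ≤ ((F.toFun n).relIndex H : NNReal) := by
      exact_mod_cast hn₀ n hn
    have h2 := ENNReal.coe_le_coe.2 h1
    rw [ENNReal.coe_rpow_of_nonneg _ hs0.le] at h2
    simpa using h2
  have htop := F.emetricSpace_toTopologicalSpace hF
  have hg : @IsTopologicalGroup G F.emetricSpace.toUniformSpace.toTopologicalSpace _ := by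
    rw [htop]; infer_instance
  have hc : @CompactSpace G F.emetricSpace.toUniformSpace.toTopologicalSpace := by
    rw [htop]; infer_instance
  have ho : ∀ n, @IsOpen G F.emetricSpace.toUniformSpace.toTopologicalSpace
      (F.toFun n : Set G) := by
    rw [htop]; exact F.isOpen
  have hcl : @IsClosed G F.emetricSpace.toUniformSpace.toTopologicalSpace (H : Set G) := by
    rw [htop]; exact hH
  let _ : MeasurableSpace G := @borel G F.emetricSpace.toUniformSpace.toTopologicalSpace
  have hb : @BorelSpace G F.emetricSpace.toUniformSpace.toTopologicalSpace _ :=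
    @BorelSpace.mk G F.emetricSpace.toUniformSpace.toTopologicalSpace _ rfl
  have htend := F.tendsto_inv_index hF
  have hne : ∀ n, ((F.toFun n).index : ℝ≥0∞)⁻¹ ≠ 0 := by simp
  have hanti : ∀ {m n : ℕ}, m ≤ n →
      ((F.toFun n).index : ℝ≥0∞)⁻¹ ≤ ((F.toFun m).index : ℝ≥0∞)⁻¹ := fun {m n} hmn => by
    rw [ENNReal.inv_le_inv, Nat.cast_le]
    exact Nat.le_of_dvd (Nat.pos_of_ne_zero (F.index_ne_zero n))
      (Subgroup.index_dvd_of_le (F.antitone hmn))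
  -- With ε strictly below the inverse index at level `n₀`, the level `m` found for a set of
  -- diameter at most ε exceeds `n₀`; in particular `m - 1` is a genuine earlier level.
  obtain ⟨ε, hε0, hε⟩ := exists_between (pos_iff_ne_zero.2 (hne n₀))
  have key := @one_le_hausdorffMeasure_subgroup G _ F.emetricSpace hg hc _ hb F.toFun ho H hcl s ε
    hε0 ?_
  · exact @le_dimH_of_hausdorffMeasure_ne_zero G F.emetricSpace _ hb _ _
      (ne_of_gt (lt_of_lt_of_le one_pos key))
  · intro U x hx hUε c hc
    have hxy : ∀ y ∈ U, F.dist y x ≤ @Metric.ediam G F.emetricSpace.toPseudoEMetricSpace U :=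
      fun y hy => @Metric.edist_le_ediam_of_mem G U y x F.emetricSpace.toPseudoEMetricSpace hy hx
    set δ := @Metric.ediam G F.emetricSpace.toPseudoEMetricSpace U
    rcases eq_or_ne δ 0 with h0 | h0
    · rw [h0, ENNReal.zero_rpow_of_pos hs0] at hc
      have ht : Tendsto (fun n => (((F.toFun n).index : ℝ≥0∞)⁻¹) ^ (s : ℝ)) atTop (𝓝 0) := by
        have := (ENNReal.continuous_rpow_const (y := (s : ℝ))).tendsto 0 |>.comp htend
        rwa [ENNReal.zero_rpow_of_pos hs0] at this
      obtain ⟨n, hn, hnn⟩ := ((ht.eventually_lt_const hc).and (eventually_ge_atTop n₀)).exists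
      refine ⟨n, fun y hy => ?_, (hpow n hnn).trans hn.le⟩
      have := hxy y hy
      rw [h0] at this
      rw [F.eq_of_dist_eq_zero (le_antisymm this zero_le), mul_inv_cancel]
      exact one_mem _
    · classical
      -- For the first level `m` whose inverse index is at most δ, points in different cosets of the
      -- `m`-th subgroup are at distance at least the inverse index at level `m - 1`, hence more
      -- than δ. So `U` lies in one coset.
      have hex : ∃ m, ((F.toFun m).index : ℝ≥0∞)⁻¹ ≤ δ :=
        (htend.eventually_le_const (pos_iff_ne_zero.2 h0)).exists
      have hspec := Nat.find_spec hex
      have hmin := fun k => Nat.find_min hex (m := k)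
      set m := Nat.find hex
      have hm : n₀ < m := by
        by_contra! hlt
        exact absurd ((hanti hlt).trans hspec) (not_le.2 (hUε.trans_lt hε))
      refine ⟨m, fun y hy => ?_,
        (hpow m hm.le).trans ((ENNReal.rpow_le_rpow hspec hs0.le).trans hc.le)⟩
      by_contra hcon
      have hlt : δ < ((F.toFun (m - 1)).index : ℝ≥0∞)⁻¹ := not_le.1 (hmin (m - 1) (by omega))
      refine absurd ((hxy y hy).trans_lt hlt) (not_lt.2 ?_)
      rw [dist, if_neg (by rintro rfl; exact hcon (by simp))]
      refine le_iInf₂ fun k hk => hanti ?_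
      by_contra! hlt
      exact hcon (F.antitone (by omega) hk)

/-- At each such level `H` is covered by `relIndex` many cosets of diameter at most the inverse
index, with `s`-sum at most `C`. Infinitely many levels suffice, since only a lower limit of these
sums enters. -/
theorem hdim_le [IsTopologicalGroup G] [CompactSpace G]
    (F : FiltrationSeries G) (hF : Tendsto (fun n => (F.toFun n).index) atTop atTop)
    {H : Subgroup G} {s C : NNReal}
    (h : ∃ᶠ n in atTop, ((F.toFun n).relIndex H : ℝ) ≤ C * ((F.toFun n).index : ℝ) ^ (s : ℝ)) :
    F.hdim (H : Set G) ≤ s := by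
  classical
  let _ : MeasurableSpace G := @borel G F.emetricSpace.toUniformSpace.toTopologicalSpace
  have hb : @BorelSpace G F.emetricSpace.toUniformSpace.toTopologicalSpace _ :=
    @BorelSpace.mk G F.emetricSpace.toUniformSpace.toTopologicalSpace _ rfl
  have hs0 : (0 : ℝ) ≤ s := s.2
  refine @dimH_le_of_hausdorffMeasure_ne_top G F.emetricSpace _ hb _ _ (ne_top_of_le_ne_top
    (ENNReal.coe_ne_top (r := C)) ?_)
  have hfin : ∀ n, Finite (H ⧸ (F.toFun n).subgroupOf H) := fun n => by
    have : ((F.toFun n).subgroupOf H).FiniteIndex := ⟨F.relIndex_ne_zero n H⟩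
    infer_instance
  let _ : ∀ n, Fintype (H ⧸ (F.toFun n).subgroupOf H) := fun n => Fintype.ofFinite _
  let t : ∀ n, (H ⧸ (F.toFun n).subgroupOf H) → Set G := fun n q =>
    {y | y * (q.out : G)⁻¹ ∈ F.toFun n}
  have hdiam : ∀ n q, @Metric.ediam G F.emetricSpace.toPseudoEMetricSpace (t n q) ≤
      ((F.toFun n).index : ℝ≥0∞)⁻¹ := fun n q =>
    @Metric.ediam_le G (t n q) F.emetricSpace.toPseudoEMetricSpace _ fun x hx y hy => by
      refine F.dist_le_of_mem ?_
      have := (F.toFun n).mul_mem hx ((F.toFun n).inv_mem hy)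
      rwa [mul_inv_rev, inv_inv, mul_assoc, inv_mul_cancel_left] at this
  refine (@MeasureTheory.Measure.hausdorffMeasure_le_liminf_sum G F.emetricSpace _ hb ℕ _ _ s (H : Set G)
    atTop _ (F.tendsto_inv_index hF) t (Eventually.of_forall hdiam)
    (Eventually.of_forall fun n x hx => ?_)).trans ?_
  · rw [Set.mem_iUnion]
    let q : H ⧸ (F.toFun n).subgroupOf H := QuotientGroup.mk (⟨x, hx⟩ : H)
    refine ⟨q, ?_⟩
    have h1 : (q.out : H)⁻¹ * ⟨x, hx⟩ ∈ (F.toFun n).subgroupOf H :=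
      QuotientGroup.eq.1 (Quotient.out_eq q)
    rw [Subgroup.mem_subgroupOf] at h1
    simpa [t, mul_comm] using h1
  · refine liminf_le_of_frequently_le' (h.mono fun n hn => ?_)
    have h1 : ((F.toFun n).relIndex H : NNReal) ≤ C * ((F.toFun n).index : NNReal) ^ (s : ℝ) := by
      exact_mod_cast hn
    have h2 := ENNReal.coe_le_coe.2 h1
    rw [ENNReal.coe_mul, ENNReal.coe_rpow_of_nonneg _ hs0] at h2
    have hi0 : ((F.toFun n).index : ℝ≥0∞) ^ (s : ℝ) ≠ 0 := by
      simp [ENNReal.rpow_eq_zero_iff, F.index_ne_zero n]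
    have hit : ((F.toFun n).index : ℝ≥0∞) ^ (s : ℝ) ≠ ⊤ :=
      ENNReal.rpow_ne_top_of_nonneg hs0 (by simp)
    calc _ ≤ ∑ _q : H ⧸ (F.toFun n).subgroupOf H, (((F.toFun n).index : ℝ≥0∞)⁻¹) ^ (s : ℝ) :=
          Finset.sum_le_sum fun q _ => ENNReal.rpow_le_rpow (hdiam n q) hs0
      _ = ((F.toFun n).relIndex H : ℝ≥0∞) * (((F.toFun n).index : ℝ≥0∞) ^ (s : ℝ))⁻¹ := by
          rw [Finset.sum_const, Finset.card_univ, ← Nat.card_eq_fintype_card, nsmul_eq_mul,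
            ENNReal.inv_rpow]
          rfl
      _ ≤ (C * ((F.toFun n).index : ℝ≥0∞) ^ (s : ℝ)) * (((F.toFun n).index : ℝ≥0∞) ^ (s : ℝ))⁻¹ := by
          gcongr
          simpa using h2
      _ = C := by rw [mul_assoc, ENNReal.mul_inv_cancel hi0 hit, mul_one]

end FiltrationSeries

/-! ### Subgroups of prescribed growth -/

section Growth

open Filter

variable {G : Type*} [CommGroup G]

/-- The quotient is abelian, killed by `n`, and generated by the images of `s`. -/
theorem relIndex_closure_dvd (F : Subgroup G) (s : Finset G) {n : ℕ}
    (h : ∀ x ∈ Subgroup.closure (s : Set G), x ^ n ∈ F) :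
    F.relIndex (Subgroup.closure (s : Set G)) ∣ n ^ s.card := by
  have hfg : Group.FG (Subgroup.closure (s : Set G)) :=
    (Group.fg_iff_subgroup_fg _).2 ⟨s, rfl⟩
  have h1 := card_dvd_exponent_pow_rank' (n := n)
    (Subgroup.closure (s : Set G) ⧸ F.subgroupOf (Subgroup.closure (s : Set G))) (by
      intro q
      induction q using QuotientGroup.induction_on with
      | H z =>
        rw [← QuotientGroup.mk_pow, QuotientGroup.eq_one_iff, Subgroup.mem_subgroupOf]
        exact h _ z.2)
  refine h1.trans (pow_dvd_pow _ ?_)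
  exact (Group.rank_le_of_surjective (QuotientGroup.mk' _) (QuotientGroup.mk'_surjective _)).trans
    (Subgroup.rank_closure_finset_le_card s)

/-- In a descending series with factors of exponent `p`, one can enlarge a finitely generated
subgroup inside `F n` such that its index at level `n + 1` is just above a given power. -/
theorem exists_fg_subgroup_succ {p : ℕ} [hp : Fact p.Prime] {F : ℕ → Subgroup G} (hF : Antitone F)
    (hfin : ∀ n, (F n).index ≠ 0) (hpow : ∀ n, ∀ x ∈ F n, x ^ p ∈ F (n + 1))
    {α : ℝ} (hα : α ≤ 1) (n : ℕ) {K : Subgroup G} (hK : K.FG)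
    (hKn : ((F n).index : ℝ) ^ α ≤ (F n).relIndex K) :
    ∃ K' : Subgroup G, K'.FG ∧ K ≤ K' ∧ K' ≤ K ⊔ F n ∧
      ((F (n + 1)).index : ℝ) ^ α ≤ (F (n + 1)).relIndex K' ∧
      (K' = K ∨ ((F (n + 1)).relIndex K' : ℝ) ≤ p * ((F (n + 1)).index : ℝ) ^ α) := by
  by_cases hcase : ((F (n + 1)).index : ℝ) ^ α ≤ (F (n + 1)).relIndex K
  · exact ⟨K, hK, le_rfl, le_sup_left, hcase, Or.inl rfl⟩
  have hrel : ∀ L, (F (n + 1)).relIndex L ≠ 0 := fun L h =>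
    hfin _ (Subgroup.index_eq_zero_of_relIndex_eq_zero h)
  have hpos : (0 : ℝ) ≤ ((F (n + 1)).index : ℝ) ^ α := by positivity
  -- Adding all of `F n` reaches the threshold: the index gains the full factor |F_n : F_(n+1)|,
  -- whereas the threshold gains only its α-th power, and α ≤ 1.
  have hbig : ((F (n + 1)).index : ℝ) ^ α ≤ (F (n + 1)).relIndex (K ⊔ F n) := by
    rw [← Subgroup.relIndex_mul_relIndex _ _ _ (hF n.le_succ) le_sup_right,
      Subgroup.relIndex_sup_right, ← Subgroup.relIndex_mul_index (hF n.le_succ)]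
    push_cast
    rw [Real.mul_rpow (by positivity) (by positivity)]
    have h1 : (1 : ℝ) ≤ ((F n.succ).relIndex (F n) : ℝ) := by
      exact_mod_cast Nat.one_le_iff_ne_zero.2 (hrel _)
    have h2 : ((F n.succ).relIndex (F n) : ℝ) ^ α ≤ ((F n.succ).relIndex (F n) : ℝ) := by
      simpa using Real.rpow_le_rpow_of_exponent_le h1 hα
    exact mul_le_mul h2 hKn (by positivity) (by positivity)
  by_contra! hcon
  -- Below the threshold, one more element of `F n` outside `L ⊔ F (n + 1)` multiplies the index by
  -- a divisor of `p` other than 1, so it grows but stays within `p` times the threshold. If this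
  -- never stopped, indices at level `n + 1` would be unbounded.
  have hstep : ∀ m : ℕ, ∃ L : Subgroup G, L.FG ∧ K ≤ L ∧ L ≤ K ⊔ F n ∧
      ((F (n + 1)).relIndex L : ℝ) ≤ p * ((F (n + 1)).index : ℝ) ^ α ∧
      m ≤ (F (n + 1)).relIndex L := by
    intro m
    induction m with
    | zero =>
      refine ⟨K, hK, le_rfl, le_sup_left, ?_, Nat.zero_le _⟩
      have : (1 : ℝ) ≤ p := by exact_mod_cast hp.out.one_lt.le
      nlinarith
    | succ m ih =>
      obtain ⟨L, hL, hKL, hLK, hLp, hm⟩ := ih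
      have hlt : ((F (n + 1)).relIndex L : ℝ) < ((F (n + 1)).index : ℝ) ^ α := by
        by_contra! h
        exact absurd hLp (not_le.2 (hcon L hL hKL hLK h).2)
      have hnot : ¬ F n ≤ L ⊔ F (n + 1) := by
        intro h
        have h1 : (F (n + 1)).relIndex (K ⊔ F n) ≤ (F (n + 1)).relIndex (L ⊔ F (n + 1)) :=
          Subgroup.relIndex_le_of_le_right (sup_le (hKL.trans le_sup_left) h) (hrel _)
        rw [Subgroup.relIndex_sup_right] at h1
        have h2 : ((F (n + 1)).relIndex (K ⊔ F n) : ℝ) ≤ (F (n + 1)).relIndex L := by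
          exact_mod_cast h1
        linarith
      obtain ⟨x, hx, hxL⟩ := SetLike.not_le_iff_exists.1 hnot
      have hindex : (F (n + 1)).relIndex (L ⊔ Subgroup.zpowers x) =
          (F (n + 1)).relIndex L * (L ⊔ F (n + 1)).relIndex (Subgroup.zpowers x) := by
        rw [← Subgroup.relIndex_sup_right, ← Subgroup.relIndex_sup_right L,
          ← Subgroup.relIndex_sup_left (Subgroup.zpowers x) (L ⊔ F (n + 1)),
          Subgroup.relIndex_mul_relIndex _ _ _ le_sup_right le_sup_left, sup_right_comm]
      have hdvd : (L ⊔ F (n + 1)).relIndex (Subgroup.zpowers x) ∣ p := by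
        have := relIndex_closure_dvd (L ⊔ F (n + 1)) {x} (n := p) fun y hy => by
          rw [Finset.coe_singleton, ← Subgroup.zpowers_eq_closure] at hy
          obtain ⟨k, rfl⟩ := hy
          refine le_sup_right (a := L) (hpow n _ (zpow_mem hx k))
        rwa [Finset.coe_singleton, ← Subgroup.zpowers_eq_closure, Finset.card_singleton,
          pow_one] at this
      have hne1 : (L ⊔ F (n + 1)).relIndex (Subgroup.zpowers x) ≠ 1 := fun h =>
        hxL (Subgroup.relIndex_eq_one.1 h (Subgroup.mem_zpowers x))
      have hle := Nat.le_of_dvd hp.out.pos hdvd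
      have hge : 2 ≤ (L ⊔ F (n + 1)).relIndex (Subgroup.zpowers x) := by
        have := Nat.pos_of_dvd_of_pos hdvd hp.out.pos
        omega
      refine ⟨L ⊔ Subgroup.zpowers x, hL.sup ⟨{x}, by simp [Subgroup.zpowers_eq_closure]⟩,
        hKL.trans le_sup_left,
        sup_le hLK ((Subgroup.zpowers_le_of_mem hx).trans le_sup_right), ?_, ?_⟩
      · rw [hindex]
        push_cast
        rw [mul_comm]
        have : ((L ⊔ F (n + 1)).relIndex (Subgroup.zpowers x) : ℝ) ≤ p := by exact_mod_cast hle
        exact mul_le_mul this hlt.le (by positivity) (by positivity)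
      · rw [hindex]
        have := Nat.pos_of_ne_zero (hrel L)
        nlinarith
  obtain ⟨L, -, -, -, -, hL⟩ := hstep ((F (n + 1)).index + 1)
  have := Nat.le_of_dvd (Nat.pos_of_ne_zero (hfin (n + 1)))
    (Subgroup.relIndex_dvd_index_of_normal (F (n + 1)) L)
  omega

theorem exists_fg_sup_eq_top {F : Subgroup G} (hF : F.index ≠ 0) :
    ∃ K : Subgroup G, K.FG ∧ K ⊔ F = ⊤ := by
  have : F.FiniteIndex := ⟨hF⟩
  have hfin : Finite (G ⧸ F) := inferInstance
  refine ⟨Subgroup.closure (Set.range (Quotient.out : G ⧸ F → G)),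
    (Subgroup.fg_iff _).2 ⟨_, rfl, @Set.finite_range _ _ _ hfin⟩, ?_⟩
  rw [eq_top_iff]
  intro x _
  rw [Subgroup.mem_sup]
  refine ⟨(QuotientGroup.mk x : G ⧸ F).out, Subgroup.subset_closure ⟨_, rfl⟩,
    (QuotientGroup.mk x : G ⧸ F).out⁻¹ * x, ?_, by simp⟩
  exact QuotientGroup.eq.1 (Quotient.out_eq (QuotientGroup.mk x : G ⧸ F))

/-- Existence of subgroups of prescribed growth with respect to a descending series with factors
of exponent `p`, if finitely generated subgroups grow slowly. -/
theorem exists_subgroup_growth {p : ℕ} [hp : Fact p.Prime] {F : ℕ → Subgroup G} (hF : Antitone F)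
    (hfin : ∀ n, (F n).index ≠ 0) (hpow : ∀ n, ∀ x ∈ F n, x ^ p ∈ F (n + 1))
    {α : ℝ} (hα : α ≤ 1)
    (hslow : ∀ K : Subgroup G, K.FG → ∀ n₀, ∃ n, n₀ ≤ n ∧
      ((F n).relIndex K : ℝ) < ((F n).index : ℝ) ^ α) :
    ∃ H : Subgroup G, (∀ n, ((F n).index : ℝ) ^ α ≤ (F n).relIndex H) ∧
      (∃ᶠ n in atTop, ((F n).relIndex H : ℝ) ≤ p * ((F n).index : ℝ) ^ α) ∧
      H = ⨅ n, H ⊔ F n := by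
  have hex : ∀ (n : ℕ) (K : Subgroup G), ∃ K' : Subgroup G, (K.FG ∧
      ((F n).index : ℝ) ^ α ≤ (F n).relIndex K) → K'.FG ∧ K ≤ K' ∧ K' ≤ K ⊔ F n ∧
      ((F (n + 1)).index : ℝ) ^ α ≤ (F (n + 1)).relIndex K' ∧
      (K' = K ∨ ((F (n + 1)).relIndex K' : ℝ) ≤ p * ((F (n + 1)).index : ℝ) ^ α) := by
    intro n K
    by_cases h : K.FG ∧ ((F n).index : ℝ) ^ α ≤ (F n).relIndex K
    · obtain ⟨K', hK'⟩ := exists_fg_subgroup_succ hF hfin hpow hα n h.1 h.2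
      exact ⟨K', fun _ => hK'⟩
    · exact ⟨K, fun h' => absurd h' h⟩
  choose f hf using hex
  obtain ⟨K₀, hK₀, hK₀F⟩ := exists_fg_sup_eq_top (hfin 0)
  let K : ℕ → Subgroup G := fun n => Nat.rec K₀ f n
  have hKs : ∀ n, K (n + 1) = f n (K n) := fun n => rfl
  have hKprop : ∀ n, (K n).FG ∧ ((F n).index : ℝ) ^ α ≤ (F n).relIndex (K n) := by
    intro n
    induction n with
    | zero =>
      refine ⟨hK₀, ?_⟩
      change ((F 0).index : ℝ) ^ α ≤ (F 0).relIndex K₀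
      rw [← Subgroup.relIndex_sup_right, hK₀F, Subgroup.relIndex_top_right]
      have h1 : (1 : ℝ) ≤ (F 0).index := by exact_mod_cast Nat.one_le_iff_ne_zero.2 (hfin 0)
      simpa using Real.rpow_le_rpow_of_exponent_le h1 hα
    | succ n ih =>
      have := hf n (K n) ih
      exact ⟨this.1, this.2.2.2.1⟩
  have hK1 : ∀ n, K n ≤ K (n + 1) := fun n => (hf n (K n) (hKprop n)).2.1
  have hK2 : ∀ n, K (n + 1) ≤ K n ⊔ F n := fun n => (hf n (K n) (hKprop n)).2.2.1
  have hK3 : ∀ n, K (n + 1) = K n ∨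
      ((F (n + 1)).relIndex (K (n + 1)) : ℝ) ≤ p * ((F (n + 1)).index : ℝ) ^ α :=
    fun n => (hf n (K n) (hKprop n)).2.2.2.2
  have hmono : Monotone K := monotone_nat_of_le_succ hK1
  have hKm : ∀ m n, K m ≤ K n ⊔ F n := by
    intro m n
    rcases le_total m n with h | h
    · exact (hmono h).trans le_sup_left
    · induction m, h using Nat.le_induction with
      | base => exact le_sup_left
      | succ m hm ih => exact (hK2 m).trans (sup_le ih ((hF hm).trans le_sup_right))
  -- Later subgroups change nothing at level `n`, because `K (m + 1) ≤ K m ⊔ F m`. The limit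
  -- therefore has the same index at level `n` as `K n`.
  have hsup : ∀ n, (⨅ n, K n ⊔ F n) ⊔ F n = K n ⊔ F n := fun n =>
    le_antisymm (sup_le (iInf_le _ n) le_sup_right)
      (sup_le_sup_right (le_iInf fun m => hKm n m) _)
  have hrel : ∀ n, (F n).relIndex (⨅ n, K n ⊔ F n) = (F n).relIndex (K n) := fun n => by
    rw [← Subgroup.relIndex_sup_right, hsup, Subgroup.relIndex_sup_right]
  refine ⟨⨅ n, K n ⊔ F n, fun n => by rw [hrel]; exact (hKprop n).2, ?_, ?_⟩
  · simp only [hrel]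
    -- If the upper bound failed from `n₀` on, no element would be added after `n₀`, and one
    -- finitely generated subgroup would stay above the threshold forever, contrary to slow growth.
    intro hev
    obtain ⟨n₀, hn₀⟩ := eventually_atTop.1 hev
    have hconst : ∀ n, n₀ ≤ n → K n = K n₀ := fun n hn => by
      induction n, hn using Nat.le_induction with
      | base => rfl
      | succ n hn ih => exact ((hK3 n).resolve_right (hn₀ (n + 1) (by omega))).trans ih
    obtain ⟨n, hn, hlt⟩ := hslow (K n₀) (hKprop n₀).1 n₀
    rw [← hconst n hn] at hlt
    exact absurd (hKprop n).2 (not_le.2 hlt)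
  · simp only [hsup]

/-- Numerical conditions on a descending series which hold for the standard filtrations of abelian
groups in characteristic `p`. -/
structure IsSlowSeries (p : ℕ) (F : ℕ → Subgroup G) : Prop where
  two_pow_le : ∀ n, 2 ^ n ≤ (F n).index
  pow_mem : ∀ n, ∀ x ∈ F n, x ^ p ∈ F (n + 1)
  exists_pow_mem : ∃ M, M ≠ 0 ∧ ∀ c n, n < 2 ^ c → ∀ x, x ^ (M * p ^ c) ∈ F n

/-- At level 2^c - 1 a subgroup with `r` generators has index dividing `(M * p ^ c) ^ r`, polynomial
in the level, while the ambient index is at least exponential in it. -/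
theorem IsSlowSeries.relIndex_lt {p : ℕ} [hp : Fact p.Prime] {F : ℕ → Subgroup G}
    (hF : IsSlowSeries p F) {α : ℝ} (hα : 0 < α) {K : Subgroup G} (hK : K.FG) (n₀ : ℕ) :
    ∃ n, n₀ ≤ n ∧ ((F n).relIndex K : ℝ) < ((F n).index : ℝ) ^ α := by
  obtain ⟨s, rfl⟩ := hK
  obtain ⟨M, hM, hMF⟩ := hF.exists_pow_mem
  set r := s.card
  -- Since `p ≤ 2 ^ p`, the factor `(p ^ c) ^ r` is at most `(2 ^ c) ^ D`, a power of `n + 1` for `n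
  -- = 2 ^ c - 1`.
  set D := p * r
  have hb : (1 : ℝ) < 2 ^ α := Real.one_lt_rpow (by norm_num) hα
  have htend := tendsto_pow_const_div_const_pow_of_one_lt D hb
  have hMpos : (0 : ℝ) < M := by exact_mod_cast Nat.pos_of_ne_zero hM
  -- The factor `2 ^ α` in the bound pays for passing from exponent `n + 1 = 2 ^ c` back to `n`.
  have hev := htend.eventually_lt_const (u := ((M : ℝ) ^ r * 2 ^ α)⁻¹) (by positivity)
  have h2 : Tendsto (fun c : ℕ => 2 ^ c) atTop atTop := tendsto_pow_atTop_atTop_of_one_lt (by norm_num)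
  obtain ⟨c, hc, hcn⟩ := ((h2.eventually hev).and (h2.eventually_ge_atTop (n₀ + 1))).exists
  obtain ⟨n, hn⟩ : ∃ n, 2 ^ c = n + 1 := ⟨2 ^ c - 1, by omega⟩
  refine ⟨n, by omega, ?_⟩
  have h3 : (F n).relIndex (Subgroup.closure (s : Set G)) ∣ (M * p ^ c) ^ r :=
    relIndex_closure_dvd _ _ fun x _ => hMF c n (by omega) x
  have h4 : (F n).relIndex (Subgroup.closure (s : Set G)) ≤ M ^ r * (2 ^ c) ^ D := by
    refine (Nat.le_of_dvd (pow_pos (Nat.mul_pos (Nat.pos_of_ne_zero hM)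
      (pow_pos hp.out.pos _)) _) h3).trans ?_
    rw [mul_pow]
    refine Nat.mul_le_mul_left _ ?_
    calc (p ^ c) ^ r ≤ ((2 ^ p) ^ c) ^ r := by
          gcongr
          exact Nat.lt_two_pow_self.le
      _ = (2 ^ c) ^ D := by
          simp only [D, ← pow_mul]
          congr 1
          ring
  rw [div_lt_iff₀ (by positivity), inv_mul_eq_div, lt_div_iff₀ (by positivity)] at hc
  calc ((F n).relIndex (Subgroup.closure (s : Set G)) : ℝ) ≤ (M : ℝ) ^ r * ((2 ^ c : ℕ) : ℝ) ^ D := by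
        exact_mod_cast h4
    _ < (2 ^ α) ^ n := by
        rw [hn, pow_succ] at hc
        rw [hn]
        have h2α : (0 : ℝ) < 2 ^ α := by positivity
        nlinarith
    _ = ((2 ^ n : ℕ) : ℝ) ^ α := by
        push_cast
        rw [← Real.rpow_natCast, ← Real.rpow_natCast, ← Real.rpow_mul (by norm_num),
          ← Real.rpow_mul (by norm_num), mul_comm]
    _ ≤ ((F n).index : ℝ) ^ α :=
        Real.rpow_le_rpow (by positivity) (by exact_mod_cast hF.two_pow_le n) hα.le

theorem IsSlowSeries.tendsto_index {p : ℕ} {F : ℕ → Subgroup G} (hF : IsSlowSeries p F) :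
    Tendsto (fun n => (F n).index) atTop atTop :=
  tendsto_atTop_mono hF.two_pow_le (tendsto_pow_atTop_atTop_of_one_lt (by norm_num))

namespace FiltrationSeries

variable [TopologicalSpace G] [IsTopologicalGroup G] [CompactSpace G] (F : FiltrationSeries G)

theorem hdim_le_one (hF : Tendsto (fun n => (F.toFun n).index) atTop atTop) (H : Subgroup G) :
    F.hdim (H : Set G) ≤ 1 := by
  refine F.hdim_le hF (s := 1) (C := 1) (Eventually.of_forall fun n => ?_).frequently
  have := Nat.le_of_dvd (Nat.pos_of_ne_zero (F.index_ne_zero n))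
    (Subgroup.relIndex_dvd_index_of_normal (F.toFun n) H)
  simpa using this

theorem exists_isClosed_hdim_eq {p : ℕ} [Fact p.Prime] (hF : IsSlowSeries p F.toFun) {α : ℝ≥0∞}
    (hα : α ≤ 1) : ∃ H : Subgroup G, IsClosed (H : Set G) ∧ F.hdim (H : Set G) = α := by
  lift α to NNReal using ne_top_of_le_ne_top ENNReal.one_ne_top hα
  -- For exponent 0 the strict slow-growth inequality is impossible, as indices are at least 1; the
  -- trivial subgroup serves instead.
  rcases eq_or_ne α 0 with rfl | h0
  · have hbot : IsClosed ((⊥ : Subgroup G) : Set G) := by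
      rw [← F.iInf_eq_bot, Subgroup.coe_iInf]
      exact isClosed_iInter fun n => (F.toFun n).isClosed_of_isOpen (F.isOpen n)
    refine ⟨⊥, hbot, le_antisymm ?_ zero_le⟩
    refine F.hdim_le hF.tendsto_index (s := 0) (C := 1) (Eventually.of_forall fun n => ?_).frequently
    simp
  · have hα1 : (α : ℝ) ≤ 1 := by exact_mod_cast hα
    obtain ⟨H, h1, h2, h3⟩ := exists_subgroup_growth (p := p) F.antitone F.index_ne_zero hF.pow_mem
      hα1 fun K hK => hF.relIndex_lt (by positivity) hK
    have hcl : IsClosed (H : Set G) := by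
      rw [h3, Subgroup.coe_iInf]
      exact isClosed_iInter fun n => (H ⊔ F.toFun n).isClosed_of_isOpen
        (Subgroup.isOpen_mono le_sup_right (F.isOpen n))
    refine ⟨H, hcl, le_antisymm ?_ (F.le_hdim hF.tendsto_index hcl (Eventually.of_forall h1))⟩
    exact F.hdim_le hF.tendsto_index (C := p) (by simpa using h2)

theorem hspec_eq {p : ℕ} [Fact p.Prime] (hF : IsSlowSeries p F.toFun) :
    F.hspec = Set.Icc 0 1 := by
  ext α
  refine ⟨?_, fun h => F.exists_isClosed_hdim_eq hF h.2⟩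
  rintro ⟨H, -, rfl⟩
  exact ⟨zero_le, F.hdim_le_one hF.tendsto_index H⟩

/-- Any `s` below the first dimension satisfies the index inequality at all large levels, since
otherwise `hdim_le` would apply. The inequality survives the shift and feeds `le_hdim`. -/
theorem hdim_le_hdim {F' : FiltrationSeries G}
    (hF : Tendsto (fun n => (F.toFun n).index) atTop atTop)
    (hF' : Tendsto (fun n => (F'.toFun n).index) atTop atTop)
    (hshift : ∃ a b, ∀ᶠ n in atTop, F.toFun (n + a) = F'.toFun (n + b))
    {H : Subgroup G} (hH : IsClosed (H : Set G)) : F.hdim (H : Set G) ≤ F'.hdim (H : Set G) := by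
  obtain ⟨a, b, hab⟩ := hshift
  refine ENNReal.le_of_forall_nnreal_lt fun s hs => F'.le_hdim hF' hH ?_
  have h1 : ∀ᶠ n in atTop, ((F.toFun n).index : ℝ) ^ (s : ℝ) ≤ (F.toFun n).relIndex H := by
    by_contra hcon
    refine absurd (F.hdim_le hF (s := s) (C := 1) (H := H) ?_) (not_le.2 hs)
    refine (not_eventually.1 hcon).mono fun n hn => ?_
    simpa using (not_le.1 hn).le
  have h2 : ∀ᶠ n in atTop, ((F'.toFun (n + b)).index : ℝ) ^ (s : ℝ) ≤
      (F'.toFun (n + b)).relIndex H := by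
    filter_upwards [hab, (tendsto_add_atTop_nat a).eventually h1] with n hn h
    rwa [← hn]
  filter_upwards [(tendsto_sub_atTop_nat b).eventually h2, eventually_ge_atTop b] with n hn hb
  rwa [Nat.sub_add_cancel hb] at hn

end FiltrationSeries

end Growth

/-! ### Congruences for analytic maps -/

section Analytic

variable {p : ℕ} {R : Type*} [CommRing R] [TopologicalSpace R] [IsProPDomain p R]
  {ι κ : Type*}

theorem hasBasis_nhds_pi [Finite ι] (v : ι → R) :
    (𝓝 v).HasBasis (fun _ => True) fun k : ℕ => {w | ∀ i, w i - v i ∈ mpow R k} := by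
  have := isTopologicalRing (R := R)
  have := Fintype.ofFinite ι
  have h0 : (𝓝 (0 : ι → R)).HasBasis (fun _ => True) fun k : ℕ => {w | ∀ i, w i ∈ mpow R k} := by
    rw [nhds_pi]
    refine (Filter.hasBasis_pi fun i => hasBasis_nhds_zero (R := R)).to_hasBasis ?_ ?_
    · rintro ⟨I, k⟩ -
      exact ⟨Finset.univ.sup k, trivial, fun w hw i _ =>
        mpow_antitone (Finset.le_sup (Finset.mem_univ i)) (hw i)⟩
    · intro k _
      exact ⟨(Set.univ, fun _ => k), ⟨Set.finite_univ, fun _ _ => trivial⟩,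
        fun w hw i => hw i trivial⟩
  have h1 := h0.comap fun w => w + -v
  rw [nhds_translation_add_neg] at h1
  simpa [sub_eq_add_neg] using h1

theorem RAnalyticAt.exists_sub_mem {f : (ι → R) → (κ → R)} {y : ι → R} (hf : RAnalyticAt f y) :
    ∃ K, ∀ k, K ≤ k → ∀ x : ι → R, (∀ i, x i ∈ mpow R k) → ∀ j,
      f (y + x) j - f y j ∈ mpow R k := by
  obtain ⟨N, F, hF⟩ := hf
  refine ⟨N, fun k hk x hx j => ?_⟩
  have h0 := hF 0 (fun i => zero_mem _) j
  rw [add_zero] at h0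
  exact (hF x (fun i => mpow_antitone hk (hx i)) j).sub_mem h0 (by simpa using hx)

theorem prod_pow_sub_prod_zero_pow_mem [Fintype ι] {x : ι → R} {k : ℕ}
    (hx : ∀ i, x i ∈ mpow R k) (m : ι → ℕ) :
    ∏ i, x i ^ m i - ∏ i, (0 : ι → R) i ^ m i ∈ mpow R k := by
  rw [← Ideal.Quotient.eq, map_prod, map_prod]
  refine Finset.prod_congr rfl fun i _ => ?_
  rw [map_pow, map_pow, Ideal.Quotient.eq_zero_iff_mem.2 (hx i), Pi.zero_apply, map_zero]

/-- The mixed second difference of a power series in two sets of variables. -/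
theorem HasValue.mixed_difference_mem [Finite ι] [Finite κ] {F : MvPowerSeries (ι ⊕ κ) R}
    {x : ι → R} {y : κ → R} {k : ℕ} (hx : ∀ i, x i ∈ mpow R k) (hy : ∀ i, y i ∈ mpow R k)
    {a b c e : R} (ha : HasValue F (Sum.elim x y) a) (hb : HasValue F (Sum.elim x 0) b)
    (hc : HasValue F (Sum.elim 0 y) c) (he : HasValue F (Sum.elim 0 0) e) :
    a - b - (c - e) ∈ mpow R (k + k) := by
  have := isTopologicalRing (R := R)
  have := Fintype.ofFinite ι
  have := Fintype.ofFinite κ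
  refine (isClosed_mpow (R := R) (k + k)).mem_of_tendsto
    (HasSum.sub (HasSum.sub ha hb) (HasSum.sub hc he)) (Filter.Eventually.of_forall fun s => ?_)
  refine Ideal.sum_mem _ fun n _ => ?_
  simp only [Finsupp.prod_fintype _ _ (fun _ => pow_zero _), Fintype.prod_sum_type, Sum.elim_inl,
    Sum.elim_inr]
  -- Each term of the mixed difference is a coefficient times (x^a - 0^a)(y^b - 0^b), with both
  -- factors in 𝔪^k. As 0^0 = 1, terms in only one set of variables drop out.
  have h1 := prod_pow_sub_prod_zero_pow_mem hx (fun i => n (Sum.inl i))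
  have h2 := prod_pow_sub_prod_zero_pow_mem hy (fun i => n (Sum.inr i))
  have h3 := Ideal.mul_mem_left _ (MvPowerSeries.coeff n F) (Ideal.mul_mem_mul h1 h2)
  rw [← pow_add] at h3
  convert h3 using 1
  ring

end Analytic

/-! ### Standard groups: power map and full spectrum -/

namespace StandardStructure

variable {p : ℕ} {R : Type*} [CommRing R] [TopologicalSpace R] [IsProPDomain p R] {d : ℕ}

section Group

variable {S : Type*} [Group S] [TopologicalSpace S] (σ : StandardStructure R d S)

theorem mul_inv_mem_subgroup_iff {n : ℕ} {x y : S} :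
    x * y⁻¹ ∈ σ.subgroup n ↔ ∀ i, (σ.φ x).1 i - (σ.φ y).1 i ∈ mpow R (σ.level + n) := by
  constructor
  · intro h i
    have := σ.law.sub_mem i h (σ.map_mul (x * y⁻¹) y i)
    rwa [inv_mul_cancel_right] at this
  · intro h i
    have h1 := (σ.map_mul x y⁻¹ i).sub_mem (σ.map_mul y y⁻¹ i) (k := σ.level + n) (by
      rintro (j | j)
      · exact h j
      · simp)
    rwa [mul_inv_cancel, σ.map_one, sub_zero] at h1

theorem hasBasis_nhds (x : S) :
    (𝓝 x).HasBasis (fun _ => True) fun n => {y | y * x⁻¹ ∈ σ.subgroup n} := by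
  have h1 : 𝓝 x = Filter.comap (fun y => (σ.φ y).1) (𝓝 (σ.φ x).1) := by
    rw [σ.φ.isInducing.nhds_eq_comap, nhds_subtype_eq_comap, Filter.comap_comap]
    rfl
  rw [h1]
  refine ((hasBasis_nhds_pi _).comap _).to_hasBasis (fun k _ => ⟨k, trivial, fun y hy i => ?_⟩)
    fun n _ => ⟨σ.level + n, trivial, fun y hy => ?_⟩
  · exact mpow_antitone (by omega) (σ.mul_inv_mem_subgroup_iff.1 hy i)
  · exact σ.mul_inv_mem_subgroup_iff.2 hy

theorem compactSpace (σ : StandardStructure R d S) : CompactSpace S := by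
  have := RAnalytic.compactSpace (R := R)
  have hcl : IsClosed {x : Fin d → R | ∀ i, x i ∈ mpow R σ.level} := by
    have : {x : Fin d → R | ∀ i, x i ∈ mpow R σ.level} =
        ⋂ i, (fun x : Fin d → R => x i) ⁻¹' (mpow R σ.level : Set R) := by
      ext x
      simp
    rw [this]
    exact isClosed_iInter fun i => (isClosed_mpow _).preimage (continuous_apply i)
  have : CompactSpace {x : Fin d → R // ∀ i, x i ∈ mpow R σ.level} :=
    isCompact_iff_compactSpace.1 hcl.isCompact
  exact σ.φ.symm.compactSpace

theorem exists_mem_maximalIdeal [Infinite S] (σ : StandardStructure R d S) :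
    0 < d ∧ ∃ t ∈ IsLocalRing.maximalIdeal R, t ≠ 0 := by
  obtain ⟨x, hx⟩ := exists_ne (1 : S)
  have hne : (σ.φ x).1 ≠ (σ.φ 1).1 := fun h => hx (σ.φ.injective (Subtype.ext h))
  obtain ⟨i, hi⟩ := Function.ne_iff.1 hne
  rw [σ.map_one] at hi
  exact ⟨i.pos, _, Ideal.pow_le_self (by have := σ.one_le_level; omega) ((σ.φ x).2 i), hi⟩

theorem subgroup_succ_lt [Infinite S] (n : ℕ) : σ.subgroup (n + 1) < σ.subgroup n := by
  refine lt_of_le_of_ne (σ.filtration.antitone n.le_succ) fun h => ?_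
  obtain ⟨hd, t, ht, h0⟩ := σ.exists_mem_maximalIdeal
  obtain ⟨x, hx, hx'⟩ := exists_mem_mpow_not_mem_succ ht h0 (σ.level + n)
  let v : {x : Fin d → R // ∀ i, x i ∈ mpow R σ.level} :=
    ⟨fun _ => x, fun _ => mpow_antitone (Nat.le_add_right _ _) hx⟩
  have h1 : σ.φ.symm v ∈ σ.subgroup n := fun i => by
    rw [σ.φ.apply_symm_apply]
    exact hx
  rw [← h] at h1
  have h2 := h1 ⟨0, hd⟩
  rw [σ.φ.apply_symm_apply] at h2
  exact hx' h2

/-- The law restricts to the identity on each axis, so its deviation from addition is a mixed second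
difference. -/
theorem map_mul_sub_mem {n : ℕ} {x y : S} (hx : x ∈ σ.subgroup n) (hy : y ∈ σ.subgroup n)
    (i : Fin d) : (σ.φ (x * y)).1 i - ((σ.φ x).1 i + (σ.φ y).1 i) ∈
      mpow R (σ.level + n + (σ.level + n)) := by
  have hone : (σ.φ 1).1 = 0 := funext σ.map_one
  have h1 := σ.map_mul x 1 i
  have h2 := σ.map_mul 1 y i
  have h3 := σ.map_mul 1 1 i
  rw [hone] at h1 h2 h3
  have := HasValue.mixed_difference_mem hx hy (σ.map_mul x y i) h1 h2 h3
  simpa [hone, sub_sub] using this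

theorem map_pow_sub_mem {n : ℕ} {x : S} (hx : x ∈ σ.subgroup n) (k : ℕ) (i : Fin d) :
    (σ.φ (x ^ k)).1 i - k * (σ.φ x).1 i ∈ mpow R (σ.level + n + (σ.level + n)) := by
  induction k with
  | zero => simp [σ.map_one]
  | succ k ih =>
    have h := add_mem (σ.map_mul_sub_mem (pow_mem hx k) hx i) ih
    rw [← pow_succ] at h
    convert h using 1
    push_cast
    ring

/-- The coordinates of `x ^ p` agree with `p` times those of `x`, that is with 0, modulo 𝔪^(2(N+n));
and 2(N+n) ≥ N + 2n + 1 because N ≥ 1. -/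
theorem pow_mem_subgroup [CharP R p] {n : ℕ} {x : S} (hx : x ∈ σ.subgroup n) :
    x ^ p ∈ σ.subgroup (2 * n + 1) := fun i => by
  have h := σ.map_pow_sub_mem hx p i
  rw [CharP.cast_eq_zero, zero_mul, sub_zero] at h
  exact mpow_antitone (by have := σ.one_le_level; omega) h

/-- Iterating n ↦ 2n + 1 from 0 gives 2^c - 1: exponential depth from `c` applications of the
`p`-power map. -/
theorem pow_pow_mem_subgroup [CharP R p] (x : S) (c : ℕ) :
    x ^ p ^ c ∈ σ.subgroup (2 ^ c - 1) := by
  induction c with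
  | zero => exact (σ.φ _).2
  | succ c ih =>
    rw [pow_succ p, pow_mul]
    have h := σ.pow_mem_subgroup ih
    have h1 := Nat.one_le_two_pow (n := c)
    rwa [show 2 * (2 ^ c - 1) + 1 = 2 ^ (c + 1) - 1 by rw [pow_succ]; omega] at h

end Group

variable {S : Type*} [CommGroup S] [TopologicalSpace S] (σ : StandardStructure R d S)

/-- A standard structure does not presuppose continuous operations; they are continuous because the
`S_n` form a basis at 1, and commutativity removes the condition on conjugation. -/
theorem isTopologicalGroup (σ : StandardStructure R d S) : IsTopologicalGroup S := by
  have h1 : (𝓝 (1 : S)).HasBasis (fun _ => True) fun n => (σ.subgroup n : Set S) := by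
    have := σ.hasBasis_nhds 1
    simp only [inv_one, mul_one] at this
    exact this
  refine IsTopologicalGroup.of_comm_of_nhds_one ?_ ?_ ?_
  · refine ((h1.prod_self).tendsto_iff h1).2 fun n _ => ⟨n, trivial, fun x hx => ?_⟩
    exact (σ.subgroup n).mul_mem hx.1 hx.2
  · exact (h1.tendsto_iff h1).2 fun n _ => ⟨n, trivial, fun x hx => (σ.subgroup n).inv_mem hx⟩
  · intro x
    have h2 : ∀ n, {y | y * x⁻¹ ∈ σ.subgroup n} = (fun y => x * y) '' (σ.subgroup n : Set S) := by
      intro n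
      ext y
      rw [Set.image_mul_left, Set.mem_preimage, mul_comm x⁻¹]
      rfl
    have h3 := σ.hasBasis_nhds x
    simp only [h2] at h3
    exact h3.eq_of_same_basis (h1.map _)

theorem isSlowSeries [Infinite S] [CharP R p] :
    IsSlowSeries p σ.filtration.toFun where
  two_pow_le n := by
    have := σ.compactSpace
    have := σ.isTopologicalGroup
    induction n with
    | zero => exact Nat.one_le_iff_ne_zero.2 (σ.filtration.index_ne_zero 0)
    | succ n ih =>
      have hlt : σ.filtration.toFun (n + 1) < σ.filtration.toFun n := σ.subgroup_succ_lt n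
      rw [← Subgroup.relIndex_mul_index hlt.le, pow_succ, mul_comm]
      refine Nat.mul_le_mul ?_ ih
      have h0 := σ.filtration.relIndex_ne_zero (n + 1) (σ.filtration.toFun n)
      have h1 : (σ.filtration.toFun (n + 1)).relIndex (σ.filtration.toFun n) ≠ 1 := fun h =>
        not_le_of_gt hlt (Subgroup.relIndex_eq_one.1 h)
      omega
  pow_mem n x hx := σ.filtration.antitone (by omega) (σ.pow_mem_subgroup hx)
  exists_pow_mem := ⟨1, one_ne_zero, fun c n hn x => by
    rw [one_mul]
    exact σ.filtration.antitone (by omega) (σ.pow_pow_mem_subgroup x c)⟩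

theorem hspec_eq [Fact p.Prime] [Infinite S] [CharP R p] :
    σ.filtration.hspec = Set.Icc 0 1 := by
  have := σ.compactSpace
  have := σ.isTopologicalGroup
  exact σ.filtration.hspec_eq σ.isSlowSeries

end StandardStructure

/-! ### Independence of the choice of standard subgroup -/

namespace OpenStandardSubgroup

variable {p : ℕ} {R : Type*} [CommRing R] [TopologicalSpace R] [IsProPDomain p R] {d : ℕ}
  {G : Type*} [CommGroup G] [TopologicalSpace G] [ChartedSpace (Fin d → R) G]

theorem mem_filtration_iff {T : OpenStandardSubgroup R d G} {n : ℕ} {g : G} :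
    g ∈ T.filtration.toFun n ↔ g ∈ T.S ∧ ∀ i, T.chart g i ∈ mpow R (T.std.level + n) := by
  constructor
  · rintro ⟨x, hx, rfl⟩
    refine ⟨x.2, fun i => ?_⟩
    rw [Subgroup.subtype_apply, T.chart_eq]
    exact hx i
  · rintro ⟨hg, h⟩
    refine ⟨⟨g, hg⟩, fun i => ?_, rfl⟩
    rw [← T.chart_eq]
    exact h i

theorem one_mem_source (T : OpenStandardSubgroup R d G) : (1 : G) ∈ T.chart.source := by
  rw [T.chart_source]
  exact one_mem _

theorem chart_one (T : OpenStandardSubgroup R d G) : T.chart 1 = 0 := by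
  have := T.chart_eq 1
  rw [OneMemClass.coe_one] at this
  rw [this]
  exact funext T.std.map_one

variable [IsTopologicalGroup G] [CompactSpace G]

theorem isSlowSeries [Infinite G] [CharP R p] (T : OpenStandardSubgroup R d G) :
    IsSlowSeries p T.filtration.toFun := by
  have hquot := Subgroup.quotient_finite_of_isOpen _ T.isOpen
  have hidx : T.S.index ≠ 0 := Subgroup.index_ne_zero_of_finite
  have hinf : Infinite T.S := by
    by_contra h
    rw [not_infinite_iff_finite] at h
    have h1 := T.S.index_mul_card
    rw [Nat.card_eq_zero_of_infinite (α := G)] at h1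
    exact mul_ne_zero hidx Nat.card_pos.ne' h1
  have hS := T.std.isSlowSeries
  -- The constant `M` is |G : S|: raising to this power moves every element of `G` into `S`, where
  -- the standard estimate applies.
  refine ⟨fun n => ?_, fun n => ?_, T.S.index, hidx, fun c n hn x => ?_⟩
  · change 2 ^ n ≤ ((T.std.filtration.toFun n).map T.S.subtype).index
    rw [Subgroup.index_map_subtype]
    exact (hS.two_pow_le n).trans (Nat.le_mul_of_pos_right _ (Nat.pos_of_ne_zero hidx))
  · rintro _ ⟨x, hx, rfl⟩
    exact ⟨x ^ p, hS.pow_mem n x hx, map_pow _ _ _⟩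
  · have hx : x ^ T.S.index ∈ T.S := T.S.pow_index_mem x
    refine ⟨(⟨_, hx⟩ : T.S) ^ p ^ c, T.std.filtration.antitone (by omega)
      (T.std.pow_pow_mem_subgroup ⟨_, hx⟩ c), ?_⟩
    rw [map_pow, pow_mul]
    rfl

/-- Deep enough terms of one standard filtration are contained in terms of the same depth of any
other standard filtration. -/
theorem exists_filtration_le (T T' : OpenStandardSubgroup R d G) :
    ∃ n₀, ∀ n, n₀ ≤ n →
      T.filtration.toFun (n + T'.std.level) ≤ T'.filtration.toFun (n + T.std.level) := by
  -- Compatibility is only given with charts of the atlas, so the comparison passes through one of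
  -- them at 1. Both changes of charts preserve congruence modulo 𝔪^k for large k, and both
  -- filtration terms have the same depth N + N' + n.
  set e := chartAt (Fin d → R) (1 : G)
  have he : e ∈ atlas (Fin d → R) G := chart_mem_atlas _ _
  have h1e : (1 : G) ∈ e.source := mem_chart_source _ _
  have ha : RAnalyticAt (fun v => e (T.chart.symm v)) (T.chart 1) :=
    (T.chart_compatible e he).2 _ (by
      rw [OpenPartialHomeomorph.trans_source, OpenPartialHomeomorph.symm_source]
      refine ⟨T.chart.map_source T.one_mem_source, ?_⟩
      rwa [Set.mem_preimage, T.chart.left_inv T.one_mem_source])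
  have hb : RAnalyticAt (fun v => T'.chart (e.symm v)) (e 1) :=
    (T'.chart_compatible e he).1 _ (by
      rw [OpenPartialHomeomorph.trans_source, OpenPartialHomeomorph.symm_source]
      refine ⟨e.map_source h1e, ?_⟩
      rw [Set.mem_preimage, e.left_inv h1e]
      exact T'.one_mem_source)
  obtain ⟨K₁, hK₁⟩ := ha.exists_sub_mem
  obtain ⟨K₂, hK₂⟩ := hb.exists_sub_mem
  obtain ⟨n₁, -, hn₁⟩ := T.filtration.hasBasis_nhds_one.mem_iff.1
    (Filter.inter_mem (e.open_source.mem_nhds h1e) (T'.isOpen.mem_nhds (one_mem T'.S)))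
  refine ⟨max n₁ (max K₁ K₂), fun n hn g hg => ?_⟩
  obtain ⟨hge, hgT'⟩ := hn₁ (T.filtration.antitone (by omega) hg)
  rw [mem_filtration_iff] at hg ⊢
  refine ⟨hgT', fun i => ?_⟩
  have h2 := hK₁ (T.std.level + (n + T'.std.level)) (by omega) (T.chart g) hg.2
  have hgs : g ∈ T.chart.source := by rw [T.chart_source]; exact hg.1
  simp only [T.chart_one, zero_add] at h2
  rw [T.chart.left_inv hgs, ← T.chart_one, T.chart.left_inv T.one_mem_source] at h2
  have h3 := hK₂ _ (by omega) (fun j => e g j - e 1 j) h2 i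
  have h4 : (e 1 + fun j => e g j - e 1 j) = e g := by
    funext j
    simp
  rw [h4, e.left_inv hge, e.left_inv h1e, T'.chart_one, Pi.zero_apply, sub_zero] at h3
  rwa [show T'.std.level + (n + T.std.level) = T.std.level + (n + T'.std.level) by omega]

theorem hdim_le_hdim [Infinite G] [CharP R p] (T T' : OpenStandardSubgroup R d G) {H : Subgroup G}
    (hH : IsClosed (H : Set G)) :
    T.filtration.hdim (H : Set G) ≤ T'.filtration.hdim (H : Set G) := by
  obtain ⟨n₁, h₁⟩ := T.exists_filtration_le T'
  obtain ⟨n₂, h₂⟩ := T'.exists_filtration_le T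
  refine T.filtration.hdim_le_hdim T.isSlowSeries.tendsto_index T'.isSlowSeries.tendsto_index
    ⟨T'.std.level, T.std.level, ?_⟩ hH
  filter_upwards [Filter.eventually_ge_atTop n₁, Filter.eventually_ge_atTop n₂] with n hn hn'
  exact le_antisymm (h₁ n hn) (h₂ n hn')

theorem isStandardHdim [Infinite G] [CharP R p] (T : OpenStandardSubgroup R d G) {H : Subgroup G}
    (hH : IsClosed (H : Set G)) : IsStandardHdim R d (H : Set G) (T.filtration.hdim (H : Set G)) :=
  ⟨⟨T⟩, fun T' => le_antisymm (T'.hdim_le_hdim T hH) (T.hdim_le_hdim T' hH)⟩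

theorem standardHspec_eq [Fact p.Prime] [Infinite G] [CharP R p] (T : OpenStandardSubgroup R d G) :
    standardHspec R d G = Set.Icc 0 1 := by
  rw [← T.filtration.hspec_eq T.isSlowSeries]
  ext α
  constructor
  · rintro ⟨H, hH, -, h⟩
    exact ⟨H, hH, h T⟩
  · rintro ⟨H, hH, rfl⟩
    exact ⟨H, hH, T.isStandardHdim hH⟩

end OpenStandardSubgroup

/-! ### Existence of an open standard subgroup -/

section LocalMul

variable {p : ℕ} {R : Type*} [CommRing R] [TopologicalSpace R] [IsProPDomain p R] {d : ℕ}
  {G : Type*} [Group G] [TopologicalSpace G]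

/-- `F` expresses the multiplication of `G` near `1` in the chart `e`, centred at `1`, on the
polydisc `(𝔪 ^ N)^(d)`, which corresponds to a neighbourhood of `1` closed under inversion. -/
structure IsLocalMul (e : OpenPartialHomeomorph G (Fin d → R)) (N : ℕ)
    (F : Fin d → MvPowerSeries (Fin d ⊕ Fin d) R) : Prop where
  one_le : 1 ≤ N
  one_mem : (1 : G) ∈ e.source
  mem_target : ∀ x : Fin d → R, (∀ i, x i ∈ mpow R N) → e 1 + x ∈ e.target
  mul_mem : ∀ x y : Fin d → R, (∀ i, x i ∈ mpow R N) → (∀ i, y i ∈ mpow R N) →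
    e.symm (e 1 + x) * e.symm (e 1 + y) ∈ e.source
  inv_mem : ∀ x : Fin d → R, (∀ i, x i ∈ mpow R N) → (e.symm (e 1 + x))⁻¹ ∈ e.source
  inv_sub_mem : ∀ x : Fin d → R, (∀ i, x i ∈ mpow R N) →
    ∀ i, e (e.symm (e 1 + x))⁻¹ i - e 1 i ∈ mpow R N
  hasValue : ∀ x y : Fin d → R, (∀ i, x i ∈ mpow R N) → (∀ i, y i ∈ mpow R N) → ∀ i,
    HasValue (F i) (Sum.elim x y) ((e (e.symm (e 1 + x) * e.symm (e 1 + y)) - e 1) i)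

theorem exists_isLocalMul [IsTopologicalGroup G] [ChartedSpace (Fin d → R) G]
    (hG : IsAnalyticGroup R d G) :
    ∃ N F, IsLocalMul (chartAt (Fin d → R) (1 : G)) N F := by
  set e := chartAt (Fin d → R) (1 : G)
  have he : e ∈ atlas (Fin d → R) G := chart_mem_atlas _ _
  have h1e : (1 : G) ∈ e.source := mem_chart_source _ _
  have hes : e.source ∈ 𝓝 (1 : G) := e.open_source.mem_nhds h1e
  obtain ⟨N₁, F, hF⟩ := hG.analytic_mul e he e he e he 1 h1e 1 h1e (by simpa using h1e)
  obtain ⟨N₂, hN₂⟩ := (hG.analytic_inv e he e he 1 h1e (by simpa using h1e)).exists_sub_mem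
  obtain ⟨V, hV, hVe⟩ := exists_nhds_one_split hes
  have hW : V ∩ (e.source)⁻¹ ∈ 𝓝 (1 : G) := Filter.inter_mem hV (inv_mem_nhds_one G hes)
  have hpre : e.target ∩ e.symm ⁻¹' (V ∩ (e.source)⁻¹) ∈ 𝓝 (e 1) := by
    refine Filter.inter_mem (e.open_target.mem_nhds (e.map_source h1e)) ?_
    refine (e.continuousAt_symm (e.map_source h1e)).preimage_mem_nhds ?_
    rwa [e.left_inv h1e]
  obtain ⟨N₃, -, hN₃⟩ := (hasBasis_nhds_pi (e 1)).mem_iff.1 hpre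
  have hle : ∀ {k : ℕ}, k ≤ N₁ + N₂ + N₃ + 1 → ∀ {x : Fin d → R},
      (∀ i, x i ∈ mpow R (N₁ + N₂ + N₃ + 1)) → ∀ i, x i ∈ mpow R k :=
    fun hk x hx i => mpow_antitone hk (hx i)
  have hmem : ∀ x : Fin d → R, (∀ i, x i ∈ mpow R (N₁ + N₂ + N₃ + 1)) →
      e 1 + x ∈ e.target ∩ e.symm ⁻¹' (V ∩ (e.source)⁻¹) := fun x hx =>
    hN₃ fun i => by simpa using hle (k := N₃) (by omega) hx i
  -- The sum dominates all three radii, and the extra 1 makes the level positive. Subtracting the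
  -- constants `e 1 i` centres the series at the identity.
  refine ⟨N₁ + N₂ + N₃ + 1, fun i => F i - MvPowerSeries.C (e 1 i), by omega, h1e,
    fun x hx => (hmem x hx).1, fun x y hx hy => hVe _ (hmem x hx).2.1 _ (hmem y hy).2.1,
    fun x hx => (hmem x hx).2.2, fun x hx i => ?_, fun x y hx hy i => ?_⟩
  · have := hN₂ _ (by omega) x hx i
    rwa [e.left_inv h1e, inv_one] at this
  · refine (hF (Sum.elim x y) ?_ i).sub (hasValue_C _ _)
    rintro (j | j)
    · exact hle (by omega) hx j
    · exact hle (by omega) hy j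

namespace IsLocalMul

theorem symm_zero {e : OpenPartialHomeomorph G (Fin d → R)} {N : ℕ}
    {F : Fin d → MvPowerSeries (Fin d ⊕ Fin d) R} (h : IsLocalMul e N F) :
    e.symm (e 1 + 0) = 1 := by
  rw [add_zero, e.left_inv h.one_mem]

theorem apply_symm {e : OpenPartialHomeomorph G (Fin d → R)} {N : ℕ}
    {F : Fin d → MvPowerSeries (Fin d ⊕ Fin d) R} (h : IsLocalMul e N F) {x : Fin d → R}
    (hx : ∀ i, x i ∈ mpow R N) : e (e.symm (e 1 + x)) - e 1 = x := by
  rw [e.right_inv (h.mem_target x hx), add_sub_cancel_left]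

theorem hasValue_zero {e : OpenPartialHomeomorph G (Fin d → R)} {N : ℕ}
    {F : Fin d → MvPowerSeries (Fin d ⊕ Fin d) R} (h : IsLocalMul e N F) (i : Fin d) :
    HasValue (F i) (Sum.elim (0 : Fin d → R) 0) 0 := by
  have := h.hasValue 0 0 (fun _ => zero_mem _) (fun _ => zero_mem _) i
  rwa [h.symm_zero, mul_one, sub_self] at this

variable {e : OpenPartialHomeomorph G (Fin d → R)} {N : ℕ}
  {F : Fin d → MvPowerSeries (Fin d ⊕ Fin d) R}

theorem constantCoeff_eq_zero (h : IsLocalMul e N F) (i : Fin d) :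
    MvPowerSeries.constantCoeff (F i) = 0 := by
  have := h.hasValue_zero i
  rw [Sum.elim_zero_zero] at this
  exact (hasValue_zero_point (F i)).unique this

theorem mul_sub_mem (h : IsLocalMul e N F) {x y : Fin d → R} (hx : ∀ i, x i ∈ mpow R N)
    (hy : ∀ i, y i ∈ mpow R N) (i : Fin d) :
    (e (e.symm (e 1 + x) * e.symm (e 1 + y)) - e 1) i ∈ mpow R N := by
  have := (h.hasValue x y hx hy i).sub_mem (h.hasValue_zero i) (k := N) (by
    rintro (j | j)
    · simpa using hx j
    · simpa using hy j)
  rwa [sub_zero] at this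

theorem mem_maximalIdeal (h : IsLocalMul e N F) {t : R} (ht : t ∈ mpow R N) :
    t ∈ IsLocalRing.maximalIdeal R :=
  Ideal.pow_le_self (by have := h.one_le; omega) ht

/-- The formal group law given by the multiplication of an analytic group near `1`. -/
def formalGroupLaw (h : IsLocalMul e N F) {t : R} (ht : t ∈ IsLocalRing.maximalIdeal R)
    (ht0 : t ≠ 0) : FormalGroupLaw R d where
  toFun := F
  right_zero i := by
    -- Each axiom of a formal group law is checked on values, where it is the corresponding group
    -- axiom, and lifted to series by the identity theorem.
    refine eq_of_hasValue_eq ht ht0 (N := N) fun x hx => ⟨x i, ?_, hasValue_X i x⟩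
    have h1 := h.hasValue x 0 hx (fun _ => zero_mem _) i
    rw [h.symm_zero, mul_one, h.apply_symm hx] at h1
    refine h1.subst ?_ ?_ fun j => h.mem_maximalIdeal (hx j)
    · rintro (j | j)
      · exact hasValue_X j x
      · exact RAnalytic.hasValue_zero x
    · rintro (j | j) <;> simp
  left_zero i := by
    refine eq_of_hasValue_eq ht ht0 (N := N) fun x hx => ⟨x i, ?_, hasValue_X i x⟩
    have h1 := h.hasValue 0 x (fun _ => zero_mem _) hx i
    rw [h.symm_zero, one_mul, h.apply_symm hx] at h1
    refine h1.subst ?_ ?_ fun j => h.mem_maximalIdeal (hx j)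
    · rintro (j | j)
      · exact RAnalytic.hasValue_zero x
      · exact hasValue_X j x
    · rintro (j | j) <;> simp
  assoc i := by
    -- The inner series must have constant term 0 for the outer substitution; this is read off by
    -- evaluating at the origin.
    have hcc : ∀ {a : Fin d ⊕ Fin d → MvPowerSeries (Fin d ⊕ Fin d ⊕ Fin d) R},
        (∀ k, MvPowerSeries.constantCoeff (a k) = 0) → ∀ j,
        MvPowerSeries.constantCoeff (MvPowerSeries.subst a (F j)) = 0 := fun {a} ha j => by
      have h1 := hasValue_zero_point (F j)
      rw [h.constantCoeff_eq_zero j] at h1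
      have h2 := h1.subst (a := a) (x := 0) (fun k => by
        have h3 := hasValue_zero_point (a k)
        rwa [ha k] at h3) ha fun _ => zero_mem _
      exact (hasValue_zero_point _).unique h2
    refine eq_of_hasValue_eq ht ht0 (N := N) fun u hu => ?_
    obtain ⟨x, y, z, rfl⟩ : ∃ x y z : Fin d → R, u = Sum.elim x (Sum.elim y z) :=
      ⟨fun j => u (Sum.inl j), fun j => u (Sum.inr (Sum.inl j)),
        fun j => u (Sum.inr (Sum.inr j)), by ext (j | j | j) <;> rfl⟩
    have hx : ∀ j, x j ∈ mpow R N := fun j => hu (Sum.inl j)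
    have hy : ∀ j, y j ∈ mpow R N := fun j => hu (Sum.inr (Sum.inl j))
    have hz : ∀ j, z j ∈ mpow R N := fun j => hu (Sum.inr (Sum.inr j))
    have hu' := fun j => h.mem_maximalIdeal (hu j)
    have hl := h.hasValue _ z (h.mul_sub_mem hx hy) hz i
    have hr := h.hasValue x _ hx (h.mul_sub_mem hy hz) i
    rw [add_sub_cancel, e.left_inv (h.mul_mem x y hx hy)] at hl
    rw [add_sub_cancel, e.left_inv (h.mul_mem y z hy hz), ← mul_assoc] at hr
    refine ⟨_, hl.subst ?_ ?_ hu', hr.subst ?_ ?_ hu'⟩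
    · rintro (j | j)
      · refine (h.hasValue x y hx hy j).subst ?_ ?_ hu'
        · rintro (k | k)
          · exact hasValue_X (Sum.inl k) _
          · exact hasValue_X (Sum.inr (Sum.inl k)) _
        · rintro (k | k) <;> simp
      · exact hasValue_X (Sum.inr (Sum.inr j)) _
    · rintro (j | j)
      · exact hcc (by rintro (k | k) <;> simp) j
      · simp
    · rintro (j | j)
      · exact hasValue_X (Sum.inl j) _
      · refine (h.hasValue y z hy hz j).subst ?_ ?_ hu'
        · rintro (k | k)
          · exact hasValue_X (Sum.inr (Sum.inl k)) _
          · exact hasValue_X (Sum.inr (Sum.inr k)) _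
        · rintro (k | k) <;> simp
    · rintro (j | j)
      · simp
      · exact hcc (by rintro (k | k) <;> simp) j

theorem symm_sub {e : OpenPartialHomeomorph G (Fin d → R)} {g : G} (hg : g ∈ e.source) :
    e.symm (e 1 + (e g - e 1)) = g := by
  rw [add_sub_cancel, e.left_inv hg]

/-- The open subgroup with coordinates in `𝔪 ^ N`. -/
def subgroup (h : IsLocalMul e N F) : Subgroup G where
  carrier := {g | g ∈ e.source ∧ ∀ i, (e g - e 1) i ∈ mpow R N}
  one_mem' := ⟨h.one_mem, fun i => by simp⟩
  mul_mem' {g k} hg hk := by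
    have h1 := h.mul_mem _ _ hg.2 hk.2
    have h2 := h.mul_sub_mem hg.2 hk.2
    rw [symm_sub hg.1, symm_sub hk.1] at h1 h2
    exact ⟨h1, h2⟩
  inv_mem' {g} hg := by
    have h1 := h.inv_mem _ hg.2
    have h2 := h.inv_sub_mem _ hg.2
    rw [symm_sub hg.1] at h1 h2
    exact ⟨h1, h2⟩

theorem mem_subgroup (h : IsLocalMul e N F) {g : G} :
    g ∈ h.subgroup ↔ g ∈ e.source ∧ ∀ i, (e g - e 1) i ∈ mpow R N := Iff.rfl

theorem isOpen_subgroup (h : IsLocalMul e N F) : IsOpen (h.subgroup : Set G) := by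
  have := isTopologicalRing (R := R)
  have hopen : IsOpen (⋂ i, (fun w : Fin d → R => (w - e 1) i) ⁻¹' (mpow R N : Set R)) :=
    isOpen_iInter_of_finite fun i => (isOpen_mpow N).preimage
      ((continuous_apply i).comp (continuous_id.sub continuous_const))
  have := e.isOpen_inter_preimage hopen
  convert this using 1
  ext g
  simp [mem_subgroup]

theorem symm_mem_subgroup (h : IsLocalMul e N F) {x : Fin d → R} (hx : ∀ i, x i ∈ mpow R N) :
    e.symm (e 1 + x) ∈ h.subgroup :=
  ⟨e.map_target (h.mem_target x hx), by rwa [h.apply_symm hx]⟩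

/-- The standard structure on the open subgroup with coordinates in `𝔪 ^ N`. -/
def standardStructure (h : IsLocalMul e N F) {t : R} (ht : t ∈ IsLocalRing.maximalIdeal R)
    (ht0 : t ≠ 0) : StandardStructure R d h.subgroup where
  level := N
  one_le_level := h.one_le
  law := h.formalGroupLaw ht ht0
  φ :=
    { toFun := fun g => ⟨e g - e 1, g.2.2⟩
      invFun := fun x => ⟨e.symm (e 1 + x.1), h.symm_mem_subgroup x.2⟩
      left_inv := fun g => Subtype.ext (symm_sub g.2.1)
      right_inv := fun x => Subtype.ext (h.apply_symm x.2)
      continuous_toFun := by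
        have := isTopologicalRing (R := R)
        exact ((e.continuousOn.comp_continuous continuous_subtype_val fun g => g.2.1).sub
          continuous_const).subtype_mk _
      continuous_invFun := by
        have := isTopologicalRing (R := R)
        exact (e.symm.continuousOn.comp_continuous (continuous_const.add continuous_subtype_val)
          fun x => h.mem_target x.1 x.2).subtype_mk _ }
  map_one i := by
    change (e 1 - e 1) i = 0
    simp
  map_mul g k i := by
    have := h.hasValue _ _ g.2.2 k.2.2 i
    rwa [symm_sub g.2.1, symm_sub k.2.1] at this

/-- The centred chart on the open subgroup with coordinates in `𝔪 ^ N`. -/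
noncomputable def chart (h : IsLocalMul e N F) : OpenPartialHomeomorph G (Fin d → R) :=
  have := isTopologicalRing (R := R)
  (e.transHomeomorph (Homeomorph.addRight (-e 1))).restrOpen h.subgroup h.isOpen_subgroup

theorem chart_apply (h : IsLocalMul e N F) (g : G) : h.chart g = e g - e 1 :=
  (sub_eq_add_neg _ _).symm

theorem chart_symm_apply (h : IsLocalMul e N F) (x : Fin d → R) :
    h.chart.symm x = e.symm (e 1 + x) := by
  rw [add_comm, ← sub_neg_eq_add, sub_eq_add_neg]
  rfl

theorem chart_source (h : IsLocalMul e N F) : h.chart.source = (h.subgroup : Set G) := by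
  change e.source ∩ (h.subgroup : Set G) = h.subgroup
  exact Set.inter_eq_right.2 fun g hg => hg.1

/-- The open standard subgroup given by the multiplication of an analytic group near `1`. -/
noncomputable def openStandardSubgroup [ChartedSpace (Fin d → R) G] (hG : IsAnalyticGroup R d G)
    (h : IsLocalMul e N F) (he : e ∈ atlas (Fin d → R) G) {t : R}
    (ht : t ∈ IsLocalRing.maximalIdeal R) (ht0 : t ≠ 0) : OpenStandardSubgroup R d G where
  S := h.subgroup
  isOpen := h.isOpen_subgroup
  std := h.standardStructure ht ht0
  chart := h.chart
  chart_source := h.chart_source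
  chart_eq g := h.chart_apply g
  chart_compatible e' he' := by
    -- The new chart is a restriction of `e` translated by a constant: in one direction only a
    -- constant series is subtracted, in the other only the base point moves.
    constructor
    · intro u hu
      rw [OpenPartialHomeomorph.trans_source, OpenPartialHomeomorph.symm_source, h.chart_source]
        at hu
      obtain ⟨M, P, hP⟩ := hG.compatible e' he' e he u
        (by
          rw [OpenPartialHomeomorph.trans_source, OpenPartialHomeomorph.symm_source]
          exact ⟨hu.1, hu.2.1⟩)
      refine ⟨M, fun j => P j - MvPowerSeries.C (e 1 j), fun x hx j => ?_⟩
      simp only [h.chart_apply]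
      exact (hP x hx j).sub (hasValue_C _ _)
    · intro u hu
      rw [OpenPartialHomeomorph.trans_source, OpenPartialHomeomorph.symm_source] at hu
      have h1 := h.chart.map_target hu.1
      rw [h.chart_source] at h1
      have h2 : e 1 + u = e (h.chart.symm u) := by
        have h3 := h.chart.right_inv hu.1
        rw [h.chart_apply] at h3
        rw [eq_add_of_sub_eq' h3]
      obtain ⟨M, P, hP⟩ := hG.compatible e he e' he' (e 1 + u)
        (by
          rw [OpenPartialHomeomorph.trans_source, OpenPartialHomeomorph.symm_source, h2]
          refine ⟨e.map_source h1.1, ?_⟩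
          rw [Set.mem_preimage, e.left_inv h1.1]
          exact hu.2)
      refine ⟨M, P, fun x hx j => ?_⟩
      simp only [h.chart_symm_apply, ← add_assoc]
      exact hP x hx j

end IsLocalMul

/-- If 𝔪 were 0, then `R`, and through a chart `G`, would be discrete, and a compact discrete group
is finite. -/
theorem IsAnalyticGroup.exists_mem_maximalIdeal [IsTopologicalGroup G] [CompactSpace G]
    [Infinite G] [ChartedSpace (Fin d → R) G] :
    ∃ t ∈ IsLocalRing.maximalIdeal R, t ≠ 0 := by
  by_contra! hcon
  have := isTopologicalRing (R := R)
  have hbot : mpow R 1 = ⊥ := by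
    rw [mpow, pow_one, eq_bot_iff]
    exact fun t ht => hcon t ht
  have hR : DiscreteTopology R := discreteTopology_of_isOpen_singleton_zero (by
    have := isOpen_mpow (R := R) 1
    rwa [hbot] at this)
  set e := chartAt (Fin d → R) (1 : G)
  have h1e : (1 : G) ∈ e.source := mem_chart_source _ _
  have hG : DiscreteTopology G := discreteTopology_of_isOpen_singleton_one (by
    have := e.isOpen_inter_preimage (isOpen_discrete {e 1})
    convert this
    ext g
    refine ⟨?_, fun hg => e.injOn hg.1 h1e hg.2⟩
    rintro rfl
    exact ⟨h1e, rfl⟩)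
  exact not_finite_iff_infinite.2 ‹_› (finite_of_compact_of_discrete (X := G))

theorem IsAnalyticGroup.nonempty_openStandardSubgroup [IsTopologicalGroup G] [CompactSpace G]
    [Infinite G] [ChartedSpace (Fin d → R) G] (hG : IsAnalyticGroup R d G) :
    Nonempty (OpenStandardSubgroup R d G) := by
  obtain ⟨t, ht, ht0⟩ := IsAnalyticGroup.exists_mem_maximalIdeal (R := R) (d := d) (G := G)
  obtain ⟨N, F, h⟩ := exists_isLocalMul hG
  exact ⟨h.openStandardSubgroup hG (chart_mem_atlas _ _) ht ht0⟩

end LocalMul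

end RAnalytic

theorem proposition4p2 (p : ℕ) [Fact p.Prime] (R : Type*) [CommRing R] [TopologicalSpace R]
    [RAnalytic.IsProPDomain p R] [CharP R p] :
    (∀ (S : Type*) [CommGroup S] [TopologicalSpace S] [Infinite S]
      (d : ℕ) (σ : RAnalytic.StandardStructure R d S),
        σ.filtration.hspec = Set.Icc 0 1) ∧
    (∀ (G : Type*) [CommGroup G] [TopologicalSpace G] [IsTopologicalGroup G] [CompactSpace G]
      [Infinite G] (d : ℕ) [ChartedSpace (Fin d → R) G], RAnalytic.IsAnalyticGroup R d G →
        (∀ H : Subgroup G, IsClosed (H : Set G) →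
          ∃ α, RAnalytic.IsStandardHdim R d (H : Set G) α) ∧
        RAnalytic.standardHspec R d G = Set.Icc 0 1) := by
  refine ⟨fun S _ _ _ d σ => σ.hspec_eq, fun G _ _ _ _ _ d _ hG => ?_⟩
  obtain ⟨T⟩ := hG.nonempty_openStandardSubgroup
  exact ⟨fun H hH => ⟨_, T.isStandardHdim hH⟩, T.standardHspec_eq⟩
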